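/- **Setting.** Let $d\ge 1$. Either $\Omega\subset\mathbb{R}^d$ is a bounded open set and $X=H^1_0(\Omega)$ (homogeneous Dirichlet condition), or $\Omega=\prod_{i=1}^d(a_i,b_i)$ is a box with $a_i<b_i$ and $X=H^1_{\rm per}(\Omega)$ (periodic conditions); in particular $\Omega$ may be a box with either boundary condition. All functions are real-valued, and $X$ carries the norm $\|u\|_{H^1}=(\|u\|_{L^2}^2+\|\nabla u\|_{L^2}^2)^{1/2}$. Let $p>1$, with $p<\frac{d+2}{d-2}$ if $d\ge 3$; let $V\in L^\infty(\Omega)$, $V\ge 0$ a.e., and $\omega>-\lambda_0$, where $\lambda_0=\inf\{\tfrac12\|\nabla u\|_{L^2}^2+\int_\Omega V|u|^2 : u\in X,\ \|u\|_{L^2}=1\}$. Put $$Q(u)=\tfrac12\|\nabla u\|_{L^2}^2+\int_\Omega V|u|^2+\omega\|u\|_{L^2}^2,\qquad G(u)=\tfrac{2}{p+1}\big(\|u\|_{L^{p+1}}^{p+1}-1\big),\qquad \mathcal S_{p+1}=\{u\in X:\|u\|_{L^{p+1}}=1\},$$ $$\widetilde\lambda(u)=Q(u)/\|u\|_{L^{p+1}}^{p+1},\qquad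 L(u,\lambda)=Q(u)-\lambda G(u).$$ Let $\alpha\ge \tfrac12\max\{0,\operatorname{ess\,sup}_\Omega (V+\omega)\}+\tfrac12$. For $\tau>0$ and $u^0\in\mathcal S_{p+1}$ the semi-discrete GFALM scheme defines $u^{n+1}\in X$ from $u^n$ by solving, weakly in $X$, $$\frac{\widetilde u^{n+1}-u^n}{\tau}=-\Big[\big(-\tfrac12\Delta+\alpha\big)\widetilde u^{n+1}+\big(V+\omega-\widetilde\lambda(u^n)|u^n|^{p-1}-\alpha\big)u^n\Big],\qquad u^{n+1}=\frac{\widetilde u^{n+1}}{\|\widetilde u^{n+1}\|_{L^{p+1}}}.$$ **Theorem.** Let $u_g\in\mathcal S_{p+1}$ be a ground state, i.e. a minimizer of $Q$ on $\mathcal S_{p+1}$, and let $\lambda_g=\widetilde\lambda(u_g)$ be its Lagrange multiplier. Assume that $u_g$ is non-degenerate: there is $c>0$ with $$\mathcal D_u^2L(u_g,\lambda_g)[\xi,\xi]\ge c\|\xi\|_{H^1}^2\qquad\text{for all }\xi\in X\text{ with }\int_\Omega|u_g|^{p-1}u_g\,\xi=0 .$$ Then there are constants $\delta_0,C,a>0$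 such that for every $u^0\in\mathcal S_{p+1}$ with $\|u^0-u_g\|_{H^1}\le\delta_0$ and every $\tau>0$, the scheme is solvable for all $n$ (with $\widetilde u^{n+1}\neq 0$), and every sequence $(u^n)_{n\ge0}$ it produces from $u^0$ satisfies $$\|u^n-u_g\|_{H^1}\le C\,e^{-a\,n\tau/(1+\tau)}\qquad\text{for all } n\in\mathbb{N}.$$ In particular $C$ and $a$ depend neither on $n$ nor on $\tau$. -/

import Mathlib

open MeasureTheory Set
open scoped ENNReal Gradient RealInnerProductSpace

noncomputable section

namespace GFALM

/-- The space `ℝ^d` with its Euclidean norm. -/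
abbrev Space (d : ℕ) : Type := EuclideanSpace ℝ (Fin d)

/-- A spatial region together with a boundary condition: either a set `Ω` with the homogeneous
Dirichlet condition, or the box `∏ i, (a i, b i)` with periodic boundary conditions. -/
inductive Region (d : ℕ) : Type
  | dirichlet (Ω : Set (Space d)) : Region d
  | periodic (a b : Fin d → ℝ) : Region d

namespace Region

variable {d : ℕ}

/-- The region as a subset of `ℝ^d`. -/
def carrier : Region d → Set (Space d)
  | dirichlet Ω => Ω
  | periodic a b => {x | ∀ i, a i < x i ∧ x i < b i}

/-- Dirichlet regions are bounded and open, periodic cells are nondegenerate boxes. -/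
def Admissible : Region d → Prop
  | dirichlet Ω => IsOpen Ω ∧ Bornology.IsBounded Ω
  | periodic a b => ∀ i, a i < b i

/-- The smooth functions compatible with the boundary condition: `C_c^∞(Ω)` in the Dirichlet case,
and the smooth functions on `ℝ^d` of period `b i - a i` in the `i`-th variable in the periodic
case. -/
def smoothFunctions : Region d → Set (Space d → ℝ)
  | dirichlet Ω => {φ | ContDiff ℝ (⊤ : ℕ∞) φ ∧ HasCompactSupport φ ∧ tsupport φ ⊆ Ω}
  | periodic a b =>
      {φ | ContDiff ℝ (⊤ : ℕ∞) φ ∧ ∀ i x, φ (x + EuclideanSpace.single i (b i - a i)) = φ x}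

/-- Lebesgue measure on the region. -/
abbrev meas (R : Region d) : Measure (Space d) := volume.restrict R.carrier

/-- Pairs `(u, g)` of an `L²` function and an `L²` vector field on the region, with the norm
`(‖u‖_{L²}² + ‖g‖_{L²}²)^{1/2}`. -/
abbrev Pairs (R : Region d) : Type :=
  WithLp 2 (Lp ℝ 2 R.meas × Lp (Space d) 2 R.meas)

/-- The pairs `(φ, ∇φ)` with `φ` smooth and compatible with the boundary condition. -/
def smoothPairs (R : Region d) : Set R.Pairs :=
  {z | ∃ φ ∈ R.smoothFunctions, z.fst =ᵐ[R.meas] φ ∧ z.snd =ᵐ[R.meas] fun x => ∇ φ x}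

/-- The real Sobolev space `X`: `H¹_0(Ω)` in the Dirichlet case and `H¹_per` of the box in the
periodic case, i.e. the closure of the smooth functions compatible with the boundary condition in
the norm `‖u‖_{H¹} = (‖u‖_{L²}² + ‖∇u‖_{L²}²)^{1/2}`. An element is recorded as the pair of the
function and its weak gradient (`integral_mul_fderiv_eq` below), so that the norm inherited from
`R.Pairs` is the `H¹` norm. -/
def sobolev (R : Region d) : Submodule ℝ R.Pairs :=
  (Submodule.span ℝ R.smoothPairs).topologicalClosure

/-- The space `X` as a type. -/
abbrev X (R : Region d) : Type := R.sobolev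

variable {R : Region d}

/-- The function underlying an element of `X` (defined up to null sets). -/
def X.fn (u : R.X) : Space d → ℝ := u.1.fst

/-- The weak gradient of an element of `X` (defined up to null sets). -/
def X.grad (u : R.X) : Space d → Space d := u.1.snd

/-- The second component of an element of `X` is the weak gradient of the first one. -/
theorem X.integral_mul_fderiv_eq (u : R.X) {ψ : Space d → ℝ} (hψ : ContDiff ℝ (⊤ : ℕ∞) ψ)
    (hc : HasCompactSupport ψ) (hs : tsupport ψ ⊆ R.carrier) (v : Space d) :
    ∫ x, u.fn x * fderiv ℝ ψ x v ∂(R.meas) = - ∫ x, ⟪u.grad x, v⟫ * ψ x ∂(R.meas) := by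
  have hψ1 : Continuous ψ := hψ.continuous
  have hfd : Continuous (fderiv ℝ ψ) := hψ.continuous_fderiv (by simp)
  have hdv : Continuous fun x => fderiv ℝ ψ x v := hfd.clm_apply continuous_const
  have hcv : HasCompactSupport fun x => fderiv ℝ ψ x v :=
    (hc.fderiv (𝕜 := ℝ)).comp_left (g := fun L : Space d →L[ℝ] ℝ => L v) (by simp)
  have hm1 : MemLp (fun x => fderiv ℝ ψ x v) 2 R.meas :=
    (hdv.memLp_of_hasCompactSupport hcv).restrict _
  have hm2 : MemLp (fun x => ψ x • v) 2 R.meas :=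
    (Continuous.memLp_of_hasCompactSupport (by fun_prop)
      (hc.smul_right (f' := fun _ => v))).restrict _
  let ℓ : R.Pairs →L[ℝ] ℝ :=
    (innerSL ℝ (hm1.toLp _)).comp (WithLp.fstL 2 ℝ _ _) +
      (innerSL ℝ (hm2.toLp _)).comp (WithLp.sndL 2 ℝ _ _)
  have hℓ (z : R.Pairs) : ℓ z = ∫ x, z.fst x * fderiv ℝ ψ x v ∂(R.meas) +
      ∫ x, ⟪z.snd x, v⟫ * ψ x ∂(R.meas) := by
    have h1 : ⟪hm1.toLp _, z.fst⟫ = ∫ x, z.fst x * fderiv ℝ ψ x v ∂(R.meas) := by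
      rw [L2.inner_def]
      refine integral_congr_ae ?_
      filter_upwards [hm1.coeFn_toLp] with x hx
      simp [hx]
    have h2 : ⟪hm2.toLp _, z.snd⟫ = ∫ x, ⟪z.snd x, v⟫ * ψ x ∂(R.meas) := by
      rw [L2.inner_def]
      refine integral_congr_ae ?_
      filter_upwards [hm2.coeFn_toLp] with x hx
      rw [hx, real_inner_smul_left, real_inner_comm, mul_comm]
    rw [← h1, ← h2]
    rfl
  have hle : R.sobolev ≤ LinearMap.ker ℓ.toLinearMap := by
    refine Submodule.topologicalClosure_minimal _ (Submodule.span_le.2 ?_) ℓ.isClosed_ker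
    rintro z ⟨φ, hφ, h1, h2⟩
    have hφs : ContDiff ℝ (⊤ : ℕ∞) φ := by
      cases R with
      | dirichlet Ω => exact hφ.1
      | periodic a b => exact hφ.1
    have hφd : Differentiable ℝ φ := hφs.differentiable (by simp)
    have hφfd : Continuous (fderiv ℝ φ) := hφs.continuous_fderiv (by simp)
    have hφ1 : Continuous φ := hφs.continuous
    have hφv : Continuous fun x => fderiv ℝ φ x v := hφfd.clm_apply continuous_const
    have e1 : ∫ x, z.fst x * fderiv ℝ ψ x v ∂(R.meas) = ∫ x, φ x * fderiv ℝ ψ x v := by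
      rw [integral_congr_ae (g := fun x => φ x * fderiv ℝ ψ x v)
        (by filter_upwards [h1] with x hx; rw [hx])]
      refine setIntegral_eq_integral_of_forall_compl_eq_zero fun x hx => ?_
      have : fderiv ℝ ψ x = 0 := by
        by_contra h
        exact hx (hs (support_fderiv_subset ℝ h))
      simp [this]
    have e2 : ∫ x, ⟪z.snd x, v⟫ * ψ x ∂(R.meas) = ∫ x, fderiv ℝ φ x v * ψ x := by
      rw [integral_congr_ae (g := fun x => fderiv ℝ φ x v * ψ x)
        (by
          filter_upwards [h2] with x hx
          simp [hx, gradient])]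
      refine setIntegral_eq_integral_of_forall_compl_eq_zero fun x hx => ?_
      rw [image_eq_zero_of_notMem_tsupport fun h => hx (hs h), mul_zero]
    change ℓ z = 0
    rw [hℓ, e1, e2, integral_mul_fderiv_eq_neg_fderiv_mul_of_integrable, neg_add_cancel]
    · exact (hφv.mul hψ1).integrable_of_hasCompactSupport hc.mul_left
    · exact (hφ1.mul hdv).integrable_of_hasCompactSupport hcv.mul_left
    · exact (hφ1.mul hψ1).integrable_of_hasCompactSupport hc.mul_left
    · exact fun x _ => hφd x
    · exact fun x _ => hψ.differentiable (by simp) x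
  have h0 : ℓ u.1 = 0 := hle u.2
  rw [hℓ] at h0
  exact eq_neg_of_add_eq_zero_left h0

/-- The `L^{p+1}` norm on `X`. -/
def normLp (p : ℝ) (u : R.X) : ℝ := lpNorm u.fn (ENNReal.ofReal (p + 1)) R.meas

/-- The `L^{p+1}` sphere `S_{p+1} = {u ∈ X : ‖u‖_{L^{p+1}} = 1}`. -/
def sphere (R : Region d) (p : ℝ) : Set R.X := {u | normLp p u = 1}

/-- The quadratic functional `Q(u) = ½‖∇u‖_{L²}² + ∫ V |u|² + ω ‖u‖_{L²}²`. -/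
def Q (V : Space d → ℝ) (ω : ℝ) (u : R.X) : ℝ :=
  (1 / 2) * ∫ x, ‖u.grad x‖ ^ 2 ∂(R.meas) + ∫ x, V x * u.fn x ^ 2 ∂(R.meas)
    + ω * ∫ x, u.fn x ^ 2 ∂(R.meas)

/-- The bottom of the spectrum of `-½Δ + V`:
`λ₀ = inf {½‖∇u‖_{L²}² + ∫ V |u|² : u ∈ X, ‖u‖_{L²} = 1}`. -/
def lambda0 (R : Region d) (V : Space d → ℝ) : ℝ :=
  sInf {q | ∃ u : R.X, ∫ x, u.fn x ^ 2 ∂(R.meas) = 1 ∧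
    q = (1 / 2) * ∫ x, ‖u.grad x‖ ^ 2 ∂(R.meas) + ∫ x, V x * u.fn x ^ 2 ∂(R.meas)}

/-- The asymptotic Lagrange multiplier `Q(u) / ‖u‖_{L^{p+1}}^{p+1}`. -/
def multiplier (V : Space d → ℝ) (ω p : ℝ) (u : R.X) : ℝ := Q V ω u / normLp p u ^ (p + 1)

/-- `u` minimizes `Q` on the `L^{p+1}` sphere. -/
def IsGroundState (V : Space d → ℝ) (ω p : ℝ) (u : R.X) : Prop :=
  u ∈ sphere R p ∧ ∀ w ∈ sphere R p, Q V ω u ≤ Q V ω w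

/-- The constraint functional `G(u) = 2/(p+1) (‖u‖_{L^{p+1}}^{p+1} - 1)`. -/
def G (p : ℝ) (u : R.X) : ℝ := 2 / (p + 1) * (normLp p u ^ (p + 1) - 1)

/-- The Lagrangian `L(u, l) = Q(u) - l G(u)`. -/
def lagrangian (V : Space d → ℝ) (ω p : ℝ) (u : R.X) (l : ℝ) : ℝ := Q V ω u - l * G p u

/-- The second variation of the Lagrangian in `u`, in direction `ξ`. -/
def secondVariation (V : Space d → ℝ) (ω p : ℝ) (u : R.X) (l : ℝ) (ξ : R.X) : ℝ :=
  iteratedDeriv 2 (fun t : ℝ => lagrangian V ω p (u + t • ξ) l) 0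

/-- The tangent space of the sphere at `u`: all `ξ ∈ X` with `∫ |u|^{p-1} u ξ = 0`. -/
def tangentSpace (p : ℝ) (u : R.X) : Set R.X :=
  {ξ | ∫ x, |u.fn x| ^ (p - 1) * u.fn x * ξ.fn x ∂(R.meas) = 0}

/-- Non-degeneracy of a ground state: the second variation of the Lagrangian, taken at the Lagrange
multiplier of `u`, is `H¹`-coercive on the tangent space. The Euler-Lagrange equation
`(-½Δ + V + ω) u = l |u|^{p-1} u`, tested with `u`, shows that the Lagrange multiplier `l` is
`multiplier V ω p u`. -/
def IsNondegenerate (V : Space d → ℝ) (ω p : ℝ) (u : R.X) : Prop :=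
  ∃ c : ℝ, 0 < c ∧ ∀ ξ ∈ tangentSpace p u,
    c * ‖ξ‖ ^ 2 ≤ secondVariation V ω p u (multiplier V ω p u) ξ

/-- One backward-forward Euler substep: `w = ũ^{n+1}` solves, weakly in `X`,
`(w - u)/τ = -[(-½Δ + α) w + (V + ω - λ̃(u)|u|^{p-1} - α) u]`, where `u = u^n`. -/
def IsEulerStep (V : Space d → ℝ) (ω p α τ : ℝ) (u w : R.X) : Prop :=
  ∀ v : R.X,
    (1 / τ) * ∫ x, (w.fn x - u.fn x) * v.fn x ∂(R.meas) =
      -((1 / 2) * ∫ x, ⟪w.grad x, v.grad x⟫ ∂(R.meas) + α * ∫ x, w.fn x * v.fn x ∂(R.meas)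
        + ∫ x, (V x + ω - multiplier V ω p u * |u.fn x| ^ (p - 1) - α) * u.fn x * v.fn x
            ∂(R.meas))

/-- The sequence `u` is produced by the semi-discrete scheme: an Euler substep followed by the
normalization `u^{n+1} = ũ^{n+1} / ‖ũ^{n+1}‖_{L^{p+1}}`, for every `n`. -/
def IsScheme (V : Space d → ℝ) (ω p α τ : ℝ) (u : ℕ → R.X) : Prop :=
  ∀ n, ∃ w : R.X, IsEulerStep V ω p α τ (u n) w ∧ normLp p w ≠ 0 ∧
    u (n + 1) = (normLp p w)⁻¹ • w

end Region

end GFALM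

end

open scoped NNReal

noncomputable section

namespace GFALM

/-! The scheme is a preconditioned gradient descent for `Q` on the sphere, and the proof tracks the
energy excess `Q u - Q ug`. Let `E` be the bilinear form of `Q`, `B` the form of the implicit
operator `1/τ + α - ½Δ`, and `e = w - u`. For `u` on the sphere the step reads `B(e, v) = -(E(u, v)
- Q(u) ∫ |u|^{p-1} u v)`.

Dissipation. Testing with `e`, the lower bound on `α` absorbs `E(e, e)` into `2 B(e, e)` for every
`τ`. Hölder's inequality gives `1 + 2N ≤ ‖w‖² - N²` in the `L^{p+1}` norm, with `N = ∫ |u|^{p-1} u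
e`, so normalization loses no energy. This is `energy_decay`, and it also yields `w ≠ 0`.

Coercivity. Write `u = ug + ξ` with `u` on the sphere. The Euler–Lagrange equation and a second
order expansion of the constraint identify the excess with half the second variation at `ξ`, up to
`o(‖ξ‖²)`. As `ξ` is tangent up to `O(‖ξ‖²)`, non-degeneracy bounds the excess below by `c ‖ξ‖²`.
The pairing of the constrained gradient at `u` with `ξ` has a bound of the same kind, because `∫
|u|^{p-1} u ug` and `∫ |ug|^{p-1} ug u` agree up to `o(‖ξ‖²)` when `u` and `ug` have equal `L^{p+1}`
norms. Both bounds are `IsGroundState.exists_local_coercive`. The expansions follow from the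
pointwise estimates `exists_taylor_abs_rpow` and `exists_abs_rpow_mul_antisymm_le`, valid for all `p
> 1`, and from the Sobolev embedding `exists_eLpNorm_fn_le`.

Rate. The pairing equals `-B(e, ξ)`, so Cauchy–Schwarz for `B` turns its lower bound into
dissipation of at least a multiple of `τ/(1+τ) ‖ξ‖²` (`le_dissipation_of_isEulerStep`). The excess
is at most a multiple of `‖ξ‖²`, hence each step multiplies it by at most `1 - κ τ/(1+τ)`
(`IsGroundState.exists_step_contraction`). Coercivity keeps the iterates near `ug` and converts
decay of the excess into decay of the distance. -/

/-! ### Sobolev inequality for functions supported in a ball. -/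

/-- The fundamental theorem of calculus on a half-line, transported from `ℝ`. It settles dimension
one, where the Gagliardo–Nirenberg–Sobolev inequality has no admissible gradient exponent `1 ≤ r <
d`. -/
theorem enorm_le_lintegral_enorm_fderiv {u : Space 1 → ℝ} (hu : ContDiff ℝ 1 u)
    (hc : HasCompactSupport u) (x : Space 1) : ‖u x‖ₑ ≤ ∫⁻ y, ‖fderiv ℝ u y‖ₑ := by
  let e : ℝ ≃ᵐ Space 1 :=
    (MeasurableEquiv.funUnique (Fin 1) ℝ).symm.trans (MeasurableEquiv.toLp 2 (Fin 1 → ℝ))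
  have he : MeasurePreserving e volume volume :=
    (volume_preserving_funUnique (Fin 1) ℝ).symm.trans
      (EuclideanSpace.volume_preserving_symm_measurableEquiv_toLp (Fin 1)).symm
  have hes (t : ℝ) : e t = t • EuclideanSpace.single (0 : Fin 1) (1 : ℝ) := by
    ext i
    have hi : i = 0 := Subsingleton.elim _ _
    subst hi
    simp [e]
  have hx : x = e (x 0) := by
    ext i
    have hi : i = 0 := Subsingleton.elim _ _
    subst hi
    simp [hes]
  have hesc : (e : ℝ → Space 1) = fun t => t • EuclideanSpace.single (0 : Fin 1) (1 : ℝ) :=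
    funext hes
  have hd (t : ℝ) : HasDerivAt e (EuclideanSpace.single (0 : Fin 1) (1 : ℝ)) t := by
    rw [hesc]
    simpa using (hasDerivAt_id t).smul_const (EuclideanSpace.single (0 : Fin 1) (1 : ℝ))
  have hud (t : ℝ) : HasDerivAt (u ∘ e) (fderiv ℝ u (e t) (EuclideanSpace.single 0 1)) t :=
    (hu.differentiable (by simp) (e t)).hasFDerivAt.comp_hasDerivAt t (hd t)
  have hcd : ContDiff ℝ 1 (u ∘ e) := by
    refine hu.comp ?_
    rw [hesc]
    fun_prop
  have hcl : Topology.IsClosedEmbedding e := by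
    rw [hesc]
    exact isClosedEmbedding_smul_left (by
      intro h
      simpa using congrArg (fun v : Space 1 => v 0) h)
  have hcc : HasCompactSupport (u ∘ e) := hc.comp_isClosedEmbedding hcl
  calc ‖u x‖ₑ = ‖(u ∘ e) (x 0)‖ₑ := by rw [Function.comp_apply, ← hx]
    _ ≤ ∫⁻ y in Iic (x 0), ‖deriv (u ∘ e) y‖ₑ := hcc.enorm_le_lintegral_Ici_deriv hcd _
    _ ≤ ∫⁻ y, ‖deriv (u ∘ e) y‖ₑ := setLIntegral_le_lintegral _ _
    _ ≤ ∫⁻ y, ‖fderiv ℝ u (e y)‖ₑ := by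
        refine lintegral_mono fun t => ?_
        rw [(hud t).deriv]
        refine (ContinuousLinearMap.le_opENorm _ _).trans ?_
        simp [enorm]
    _ = ∫⁻ y, ‖fderiv ℝ u y‖ₑ :=
        he.lintegral_comp_emb e.measurableEmbedding fun y => ‖fderiv ℝ u y‖ₑ

/-- Gagliardo–Nirenberg–Sobolev with a gradient exponent `r ≤ 2`, followed by Hölder on the ball to
raise `r` to `2`. -/
theorem exists_eLpNorm_le_eLpNorm_fderiv_two {d : ℕ} (hd : 1 ≤ d) {q : ℝ≥0} (hq : 1 ≤ q)
    (hq' : 3 ≤ d → (1 / 2 : ℝ) - 1 / d ≤ 1 / q) (ρ : ℝ) :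
    ∃ C : ℝ≥0, ∀ u : Space d → ℝ, ContDiff ℝ 1 u →
      Function.support u ⊆ Metric.closedBall 0 ρ →
        eLpNorm u q volume ≤ C * eLpNorm (fderiv ℝ u) 2 volume := by
  set S : Set (Space d) := Metric.closedBall 0 ρ with hS
  have hSfin : volume S ≠ ∞ := (isCompact_closedBall _ _).measure_lt_top.ne
  have hsupp {u : Space d → ℝ} (h : Function.support u ⊆ S) :
      Function.support (fderiv ℝ u) ⊆ S :=
    (support_fderiv_subset ℝ).trans
      (closure_minimal h Metric.isClosed_closedBall)
  have hlow (r : ℝ≥0) (hr : r ≤ 2) : ∃ C : ℝ≥0, ∀ u : Space d → ℝ, ContDiff ℝ 1 u →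
      Function.support u ⊆ S →
        eLpNorm (fderiv ℝ u) r volume ≤ C * eLpNorm (fderiv ℝ u) 2 volume := by
    rcases eq_or_ne r 0 with rfl | hr0
    · exact ⟨0, fun u _ _ => by simp⟩
    have hfin : volume S ^ (1 / (r : ℝ≥0∞).toReal - 1 / (2 : ℝ≥0∞).toReal) ≠ ∞ := by
      refine ENNReal.rpow_ne_top_of_nonneg ?_ hSfin
      rw [sub_nonneg]
      refine one_div_le_one_div_of_le ?_ ?_
      · simpa using pos_iff_ne_zero.2 hr0
      · simpa using (by exact_mod_cast hr : (r : ℝ) ≤ 2)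
    refine ⟨(volume S ^ (1 / (r : ℝ≥0∞).toReal - 1 / (2 : ℝ≥0∞).toReal)).toNNReal,
      fun u hu hus => ?_⟩
    rw [ENNReal.coe_toNNReal hfin]
    have h := eLpNorm_le_eLpNorm_mul_rpow_measure_univ (μ := volume.restrict S)
      (f := fderiv ℝ u) (p := (r : ℝ≥0∞)) (q := 2) (by exact_mod_cast hr)
      (hu.continuous_fderiv (by simp)).aestronglyMeasurable
    have hres (s : ℝ≥0∞) :
        eLpNorm (fderiv ℝ u) s (volume.restrict S) = eLpNorm (fderiv ℝ u) s volume := by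
      rw [← eLpNorm_norm, ← eLpNorm_norm (fderiv ℝ u)]
      refine eLpNorm_restrict_eq_of_support_subset fun x hx => hsupp hus ?_
      simpa using hx
    rw [hres, hres] at h
    simpa [mul_comm] using h
  have hq0 : (0 : ℝ) < q := by exact_mod_cast zero_lt_one.trans_le hq
  rcases eq_or_lt_of_le hd with h1 | h1
  · subst h1
    obtain ⟨C, hC⟩ := hlow 1 (by norm_num)
    have hfin : volume S ^ ((q : ℝ≥0∞).toReal⁻¹) ≠ ∞ :=
      ENNReal.rpow_ne_top_of_nonneg (by positivity) hSfin
    refine ⟨C * (volume S ^ ((q : ℝ≥0∞).toReal⁻¹)).toNNReal, fun u hu hus => ?_⟩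
    have hcs : HasCompactSupport u :=
      HasCompactSupport.of_support_subset_isCompact (isCompact_closedBall _ _) hus
    have h := eLpNorm_le_of_ae_enorm_bound (μ := volume.restrict S) (p := q) (f := u)
      (Filter.Eventually.of_forall (enorm_le_lintegral_enorm_fderiv hu hcs))
    rw [eLpNorm_restrict_eq_of_support_subset hus, Measure.restrict_apply_univ,
      ← eLpNorm_one_eq_lintegral_enorm, smul_eq_mul] at h
    refine h.trans ?_
    rw [ENNReal.coe_mul, ENNReal.coe_toNNReal hfin, mul_right_comm]
    gcongr
    simpa using hC u hu hus
  · obtain ⟨r, hr1, hr2, hrd, hrq⟩ : ∃ r : ℝ≥0, 1 ≤ r ∧ r ≤ 2 ∧ (r : ℝ) < d ∧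
        (r : ℝ)⁻¹ - (d : ℝ)⁻¹ ≤ (q : ℝ)⁻¹ := by
      rcases Nat.lt_or_ge 2 d with h2 | h2
      · refine ⟨2, by norm_num, le_rfl, by exact_mod_cast h2, ?_⟩
        simpa using hq' h2
      · obtain rfl : d = 2 := le_antisymm h2 h1
        -- In dimension two `r = 2` is excluded. The value `2q/(q+2)` solves `1/r - 1/2 = 1/q` and
        -- is below `2`; the maximum enforces `r ≥ 1`.
        refine ⟨max 1 (2 * q / (q + 2)), le_max_left _ _, max_le (by norm_num) ?_, ?_, ?_⟩
        · rw [div_le_iff₀ (by positivity)]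
          gcongr
          simp
        · push_cast
          refine max_lt (by norm_num) ?_
          rw [div_lt_iff₀ (by positivity)]
          linarith
        · push_cast
          have h3 : (max 1 (2 * q / (q + 2)) : ℝ)⁻¹ ≤ (2 * q / (q + 2) : ℝ)⁻¹ := by
            gcongr
            exact le_max_right _ _
          refine (sub_le_sub_right h3 _).trans (le_of_eq ?_)
          field_simp
          ring
    obtain ⟨C, hC⟩ := hlow r hr2
    refine ⟨eLpNormLESNormFDerivOfLeConst ℝ (volume : Measure (Space d)) S r q * C,
      fun u hu hus => ?_⟩
    have h := eLpNorm_le_eLpNorm_fderiv_of_le (volume : Measure (Space d)) hu hus (p := r) (q := q)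
      hr1 (by rw [finrank_euclideanSpace_fin]; exact_mod_cast hrd) (by simpa using hrq) Metric.isBounded_closedBall
    refine h.trans ?_
    rw [ENNReal.coe_mul, mul_assoc]
    gcongr
    exact hC u hu hus

/-! ### Integrals of periodic functions over balls. -/

theorem volume_setOf_apply_eq {d : ℕ} (i : Fin d) (c : ℝ) :
    volume {x : Space d | x i = c} = 0 := by
  have h := (EuclideanSpace.volume_preserving_symm_measurableEquiv_toLp (Fin d)).measure_preimage
    (s := {f : Fin d → ℝ | f i = c})
    (measurableSet_eq_fun (measurable_pi_apply i) measurable_const).nullMeasurableSet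
  rw [volume_pi, Measure.pi_hyperplane] at h
  exact h

/-- The integral over a ball of a function which is periodic with respect to a box is controlled
by its integral over the box. -/
theorem exists_setLIntegral_closedBall_le {d : ℕ} {a b : Fin d → ℝ} (hab : ∀ i, a i < b i)
    (ρ : ℝ) : ∃ K : ℕ, ∀ f : Space d → ℝ≥0∞, Measurable f →
      (∀ i x, f (x + EuclideanSpace.single i (b i - a i)) = f x) →
        ∫⁻ x in Metric.closedBall 0 ρ, f x ≤
          K * ∫⁻ x in {x : Space d | ∀ i, a i < x i ∧ x i < b i}, f x := by
  set B : Set (Space d) := {x | ∀ i, a i < x i ∧ x i < b i} with hB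
  -- Half-open cells tile the space exactly, so finitely many translates cover the ball; the open
  -- cell differs from `B'` only by null faces.
  set B' : Set (Space d) := {x | ∀ i, a i ≤ x i ∧ x i < b i} with hB'
  let s : (Fin d → ℤ) → Space d := fun k => ∑ i, k i • EuclideanSpace.single i (b i - a i)
  have hs (k : Fin d → ℤ) (i : Fin d) : s k i = k i * (b i - a i) := by
    simp [s, Finset.sum_apply, Pi.single_apply]
  obtain ⟨m, hm⟩ : ∃ m : Fin d → ℤ, ∀ i, (ρ + |a i|) / (b i - a i) ≤ m i := by
    choose m hm using fun i => exists_int_gt ((ρ + |a i|) / (b i - a i))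
    exact ⟨m, fun i => (hm i).le⟩
  let T : Finset (Fin d → ℤ) := Finset.Icc (fun i => -m i - 1) m
  have hcover : Metric.closedBall (0 : Space d) ρ ⊆ ⋃ k ∈ T, (fun x => x + s k) ⁻¹' B' := by
    intro x hx
    have hxi (i : Fin d) : |x i| ≤ ρ :=
      (PiLp.norm_apply_le x i).trans (mem_closedBall_zero_iff.1 hx)
    have hfl (i : Fin d) := Int.floor_le ((x i - a i) / (b i - a i))
    have hfl' (i : Fin d) := Int.lt_floor_add_one ((x i - a i) / (b i - a i))
    have hL (i : Fin d) : 0 < b i - a i := sub_pos.2 (hab i)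
    have habs (i : Fin d) : |(x i - a i) / (b i - a i)| ≤ m i := by
      refine le_trans ?_ (hm i)
      rw [abs_div, abs_of_pos (hL i)]
      have := hL i
      gcongr
      exact (abs_sub _ _).trans (by gcongr; exact hxi i)
    refine mem_iUnion₂.2 ⟨fun i => -⌊(x i - a i) / (b i - a i)⌋, ?_, fun i => ?_⟩
    · refine Finset.mem_Icc.2 ⟨fun i => ?_, fun i => ?_⟩
      · have h1 := (abs_le.1 (habs i)).2
        have h2 : (⌊(x i - a i) / (b i - a i)⌋ : ℝ) ≤ m i := (hfl i).trans h1
        have h3 : ⌊(x i - a i) / (b i - a i)⌋ ≤ m i := by exact_mod_cast h2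
        change -m i - 1 ≤ -⌊(x i - a i) / (b i - a i)⌋
        omega
      · have h1 := (abs_le.1 (habs i)).1
        have h3 : -m i ≤ ⌊(x i - a i) / (b i - a i)⌋ := by
          rw [Int.le_floor]
          push_cast
          exact h1
        change -⌊(x i - a i) / (b i - a i)⌋ ≤ m i
        omega
    · have h1 := hfl i
      have h2 := hfl' i
      rw [le_div_iff₀ (hL i)] at h1
      rw [div_lt_iff₀ (hL i)] at h2
      change a i ≤ (x + s _) i ∧ (x + s _) i < b i
      rw [PiLp.add_apply, hs]
      push_cast
      constructor <;> linarith
  have hBB : B' =ᵐ[volume] B := by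
    refine Filter.EventuallyLE.antisymm ?_ ?_
    · rw [ae_le_set]
      refine measure_mono_null (t := ⋃ i, {x : Space d | x i = a i}) ?_
        (measure_iUnion_null fun i => volume_setOf_apply_eq i (a i))
      rintro x ⟨hx, hx'⟩
      by_contra hcon
      simp only [mem_iUnion, mem_ofPred_eq, not_exists] at hcon
      exact hx' fun i => ⟨lt_of_le_of_ne (hx i).1 (Ne.symm (hcon i)), (hx i).2⟩
    · exact Filter.Eventually.of_forall fun x hx i => ⟨(hx i).1.le, (hx i).2⟩
  have hB'm : MeasurableSet B' := by
    have : B' = ⋂ i, {x : Space d | a i ≤ x i ∧ x i < b i} := by ext; simp [hB']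
    rw [this]
    refine MeasurableSet.iInter fun i => ?_
    have hm : Measurable fun x : Space d => x i := by fun_prop
    exact (measurableSet_le measurable_const hm).inter (measurableSet_lt hm measurable_const)
  refine ⟨T.card, fun f hfm hf => ?_⟩
  have hper (k : Fin d → ℤ) (x : Space d) : f (x + s k) = f x := by
    let P : AddSubgroup (Space d) :=
      { carrier := {v | ∀ x, f (x + v) = f x}
        zero_mem' := fun x => by rw [add_zero]
        add_mem' := fun {v w} hv hw x => by rw [← add_assoc, hw, hv]
        neg_mem' := fun {v} hv x => by
          have := hv (x + -v)
          rwa [neg_add_cancel_right, eq_comm] at this }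
    have : s k ∈ P := sum_mem fun i _ => zsmul_mem (show _ ∈ P from fun x => hf i x) _
    exact this x
  calc ∫⁻ x in Metric.closedBall 0 ρ, f x
      ≤ ∫⁻ x in ⋃ k ∈ T, (fun x => x + s k) ⁻¹' B', f x := lintegral_mono_set hcover
    _ ≤ ∑ k ∈ T, ∫⁻ x in (fun x => x + s k) ⁻¹' B', f x := by
        have h := lintegral_iUnion_le (μ := volume)
          (fun k : T => (fun x : Space d => x + s k) ⁻¹' B') f
        rw [tsum_fintype, Finset.sum_coe_sort T
          fun k => ∫⁻ x in (fun x : Space d => x + s k) ⁻¹' B', f x] at h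
        rwa [iUnion_subtype] at h
    _ = ∑ k ∈ T, ∫⁻ x in B, f x := by
        refine Finset.sum_congr rfl fun k _ => ?_
        rw [← setLIntegral_congr hBB]
        have h := (measurePreserving_add_right (volume : Measure (Space d)) (s k)).setLIntegral_comp_preimage
          hB'm hfm
        rw [← h]
        exact lintegral_congr fun x => (hper k x).symm
    _ = T.card * ∫⁻ x in B, f x := by rw [Finset.sum_const, nsmul_eq_mul]

theorem norm_gradient_eq {d : ℕ} (φ : Space d → ℝ) (x : Space d) : ‖∇ φ x‖ = ‖fderiv ℝ φ x‖ := by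
  simp [gradient]

theorem eLpNorm_gradient {d : ℕ} (φ : Space d → ℝ) (q : ℝ≥0∞) (μ : Measure (Space d)) :
    eLpNorm (∇ φ) q μ = eLpNorm (fderiv ℝ φ) q μ := by
  rw [← eLpNorm_norm, ← eLpNorm_norm (fderiv ℝ φ)]
  simp_rw [norm_gradient_eq]

/-! ### Sobolev embedding of the energy space. -/

namespace Region

variable {d : ℕ}

theorem contDiff_of_mem_smoothFunctions {R : Region d} {φ : Space d → ℝ}
    (hφ : φ ∈ R.smoothFunctions) : ContDiff ℝ (⊤ : ℕ∞) φ := by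
  cases R with
  | dirichlet Ω => exact hφ.1
  | periodic a b => exact hφ.1

theorem exists_eLpNorm_two_closedBall_le {a b : Fin d → ℝ} (hab : ∀ i, a i < b i) (ρ : ℝ) :
    ∃ K : ℝ≥0, ∀ f : Space d → ℝ, Measurable f →
      (∀ i x, f (x + EuclideanSpace.single i (b i - a i)) = f x) →
        eLpNorm f 2 (volume.restrict (Metric.closedBall 0 ρ)) ≤
          K * eLpNorm f 2 (periodic a b).meas := by
  obtain ⟨K, hK⟩ := exists_setLIntegral_closedBall_le hab ρ
  refine ⟨(K : ℝ≥0) ^ (1 / 2 : ℝ), fun f hfm hf => ?_⟩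
  rw [eLpNorm_eq_lintegral_rpow_enorm_toReal (by simp) (by simp),
    eLpNorm_eq_lintegral_rpow_enorm_toReal (by simp) (by simp), ENNReal.toReal_ofNat,
    ENNReal.coe_rpow_of_nonneg _ (by norm_num), ENNReal.coe_natCast,
    ← ENNReal.mul_rpow_of_nonneg _ _ (by norm_num)]
  gcongr
  exact hK _ (by fun_prop) fun i x => by rw [hf]

/-- A Dirichlet function is already supported in a ball. A periodic one is multiplied by a bump
equal to one on the cell; the product rule costs the `L²` norm of the function, and periodicity
brings the norms over the larger ball back to the cell. -/
theorem exists_eLpNorm_le_of_mem_smoothFunctions (hd : 1 ≤ d) (R : Region d) (hR : R.Admissible)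
    {q : ℝ≥0} (hq : 1 ≤ q) (hq' : 3 ≤ d → (1 / 2 : ℝ) - 1 / d ≤ 1 / q) :
    ∃ C : ℝ≥0, ∀ φ ∈ R.smoothFunctions,
      eLpNorm φ q R.meas ≤ C * (eLpNorm φ 2 R.meas + eLpNorm (∇ φ) 2 R.meas) := by
  cases R with
  | dirichlet Ω =>
    obtain ⟨-, hb⟩ := hR
    obtain ⟨ρ, hρ⟩ := hb.subset_closedBall 0
    obtain ⟨C, hC⟩ := exists_eLpNorm_le_eLpNorm_fderiv_two hd hq hq' ρ
    refine ⟨C, fun φ ⟨hφ, hc, hs⟩ => ?_⟩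
    have hsupp : Function.support φ ⊆ Metric.closedBall 0 ρ :=
      (subset_tsupport φ).trans (hs.trans hρ)
    calc eLpNorm φ q (dirichlet Ω).meas ≤ eLpNorm φ q volume :=
          eLpNorm_mono_measure _ Measure.restrict_le_self
      _ ≤ C * eLpNorm (fderiv ℝ φ) 2 volume :=
          hC φ (hφ.of_le (by simp)) hsupp
      _ = C * eLpNorm (∇ φ) 2 (dirichlet Ω).meas := by
          rw [← eLpNorm_gradient]
          congr 1
          refine (eLpNorm_restrict_eq_of_support_subset fun x hx => ?_).symm
          refine hs (support_fderiv_subset ℝ ?_)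
          rw [Function.mem_support] at hx ⊢
          rwa [← norm_ne_zero_iff, ← norm_gradient_eq, norm_ne_zero_iff]
      _ ≤ _ := by
          gcongr
          exact le_add_self
  | periodic a b =>
    have hab : ∀ i, a i < b i := hR
    obtain ⟨ρ, hρ0, hρ⟩ : ∃ ρ : ℝ, 0 < ρ ∧ (periodic a b).carrier ⊆ Metric.closedBall 0 ρ := by
      refine ⟨∑ i, (|a i| + |b i|) + 1, ?_, fun x hx => ?_⟩
      · have : 0 ≤ ∑ i, (|a i| + |b i|) := Finset.sum_nonneg fun i _ => by positivity
        linarith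
      · rw [mem_closedBall_zero_iff]
        have h1 : ‖x‖ ≤ ∑ i, ‖x i‖ := by
          conv_lhs => rw [← (EuclideanSpace.basisFun (Fin d) ℝ).sum_repr x]
          refine (norm_sum_le _ _).trans (Finset.sum_le_sum fun i _ => ?_)
          simp [norm_smul]
        refine h1.trans (le_trans (Finset.sum_le_sum fun i _ => ?_) (le_add_of_nonneg_right zero_le_one))
        obtain ⟨h2, h3⟩ := hx i
        rw [Real.norm_eq_abs, abs_le]
        have := neg_abs_le (a i)
        have := le_abs_self (b i)
        have := abs_nonneg (a i)
        have := abs_nonneg (b i)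
        constructor <;> linarith
    let χ : ContDiffBump (0 : Space d) := ⟨ρ, ρ + 1, hρ0, by linarith⟩
    obtain ⟨M, hM⟩ : ∃ M : ℝ, ∀ x, ‖fderiv ℝ χ x‖ ≤ M :=
      (χ.hasCompactSupport.fderiv ℝ).exists_bound_of_continuous
        ((χ.contDiff (n := 1)).continuous_fderiv (by simp))
    have hM0 : 0 ≤ M := (norm_nonneg _).trans (hM 0)
    lift M to ℝ≥0 using hM0
    obtain ⟨C, hC⟩ := exists_eLpNorm_le_eLpNorm_fderiv_two hd hq hq' (ρ + 1)
    obtain ⟨K, hK⟩ := exists_eLpNorm_two_closedBall_le hab (ρ + 1)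
    refine ⟨C * (K * (1 + M)), fun φ ⟨hφ, hper⟩ => ?_⟩
    have hφ1 : ContDiff ℝ 1 φ := hφ.of_le (by simp)
    have hu : ContDiff ℝ 1 (fun x => χ x * φ x) := χ.contDiff.mul hφ1
    have hsupp : Function.support (fun x => χ x * φ x) ⊆ Metric.closedBall 0 (ρ + 1) := by
      intro x hx
      have : x ∈ Function.support χ := fun h => hx (by simp [h])
      rw [χ.support_eq] at this
      exact Metric.ball_subset_closedBall this
    have hperd (i : Fin d) (x : Space d) :
        fderiv ℝ φ (x + EuclideanSpace.single i (b i - a i)) = fderiv ℝ φ x := by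
      rw [← fderiv_comp_add_right]
      congr 1
      exact funext (hper i)
    have hder (x : Space d) : ‖fderiv ℝ (fun x => χ x * φ x) x‖ ≤ ‖fderiv ℝ φ x‖ + M * ‖φ x‖ := by
      rw [fderiv_fun_mul (χ.contDiff.differentiable (n := 1) (by simp) x)
        (hφ1.differentiable (by simp) x)]
      refine (norm_add_le _ _).trans ?_
      rw [norm_smul, norm_smul, mul_comm ‖φ x‖, Real.norm_of_nonneg χ.nonneg]
      gcongr
      · exact mul_le_of_le_one_left (norm_nonneg _) χ.le_one
      · exact hM x
    set S : Set (Space d) := Metric.closedBall 0 (ρ + 1) with hS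
    calc eLpNorm φ q (periodic a b).meas
        = eLpNorm (fun x => χ x * φ x) q (periodic a b).meas := by
          refine eLpNorm_congr_ae ?_
          have hmeas : MeasurableSet (periodic a b).carrier := by
            have : (periodic a b).carrier = ⋂ i, {x : Space d | a i < x i ∧ x i < b i} := by
              ext; simp [carrier]
            rw [this]
            refine MeasurableSet.iInter fun i => ?_
            have hm : Measurable fun x : Space d => x i := by fun_prop
            exact (measurableSet_lt measurable_const hm).inter (measurableSet_lt hm measurable_const)
          filter_upwards [ae_restrict_mem hmeas] with x hx
          rw [χ.one_of_mem_closedBall (hρ hx), one_mul]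
      _ ≤ eLpNorm (fun x => χ x * φ x) q volume :=
          eLpNorm_mono_measure _ Measure.restrict_le_self
      _ ≤ C * eLpNorm (fderiv ℝ fun x => χ x * φ x) 2 volume := hC _ hu hsupp
      _ = C * eLpNorm (fun x => ‖fderiv ℝ (fun x => χ x * φ x) x‖) 2 (volume.restrict S) := by
          rw [← eLpNorm_norm (fderiv ℝ _)]
          congr 1
          refine (eLpNorm_restrict_eq_of_support_subset fun x hx => ?_).symm
          refine closure_minimal hsupp Metric.isClosed_closedBall (support_fderiv_subset ℝ ?_)
          simpa using hx
      _ ≤ C * eLpNorm ((fun x => ‖fderiv ℝ φ x‖) + fun x => M * ‖φ x‖) 2 (volume.restrict S) := by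
          gcongr
          refine eLpNorm_mono fun x => ?_
          rw [norm_norm, Pi.add_apply, Real.norm_of_nonneg (by positivity)]
          exact hder x
      _ ≤ C * (eLpNorm (fun x => ‖fderiv ℝ φ x‖) 2 (volume.restrict S) +
            eLpNorm (fun x => M * ‖φ x‖) 2 (volume.restrict S)) := by
          gcongr
          refine eLpNorm_add_le ?_ ?_ (by norm_num)
          · exact (hφ1.continuous_fderiv (by simp)).norm.aestronglyMeasurable
          · exact (continuous_const.mul hφ1.continuous.norm).aestronglyMeasurable
      _ ≤ C * (K * eLpNorm (fun x => ‖fderiv ℝ φ x‖) 2 (periodic a b).meas +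
            M * (K * eLpNorm φ 2 (periodic a b).meas)) := by
          gcongr
          · exact hK _ (hφ1.continuous_fderiv (by simp)).norm.measurable fun i x => by rw [hperd]
          · have h : eLpNorm (fun x => M * ‖φ x‖) 2 (volume.restrict S) =
                M * eLpNorm φ 2 (volume.restrict S) := by
              rw [← eLpNorm_norm φ]
              have := eLpNorm_const_smul (M : ℝ) (fun x => ‖φ x‖) 2 (volume.restrict S)
              simpa [Pi.smul_def] using this
            rw [h]
            gcongr
            exact hK _ hφ1.continuous.measurable hper
      _ ≤ _ := by
          rw [eLpNorm_norm (fderiv ℝ φ), ← eLpNorm_gradient]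
          push_cast
          rw [mul_assoc (C : ℝ≥0∞)]
          gcongr
          generalize eLpNorm φ 2 (periodic a b).meas = s
          generalize eLpNorm (∇ φ) 2 (periodic a b).meas = t
          calc (K : ℝ≥0∞) * t + M * (K * s) = K * (t + M * s) := by ring
            _ ≤ K * ((s + t) + M * (s + t)) := by
              gcongr
              · exact le_add_self
              · exact le_self_add
            _ = _ := by ring

/-- The smooth pairs already form a subspace, so the elements approximating a point of `X` are
themselves pairs `(φ, ∇φ)`. -/
theorem exists_smooth_of_mem_span {R : Region d} {z : R.Pairs}
    (hz : z ∈ Submodule.span ℝ R.smoothPairs) : z ∈ R.smoothPairs := by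
  induction hz using Submodule.span_induction with
  | mem z hz => exact hz
  | zero =>
    refine ⟨0, ?_, ?_, ?_⟩
    · cases R with
      | dirichlet Ω => exact ⟨contDiff_const, HasCompactSupport.zero, by simp⟩
      | periodic a b => exact ⟨contDiff_const, by simp⟩
    · exact Lp.coeFn_zero _ _ _
    · refine (Lp.coeFn_zero _ _ _).trans (Filter.Eventually.of_forall fun x => ?_)
      simp [gradient]
  | add z w _ _ hz hw =>
    obtain ⟨φ, hφ, h1, h2⟩ := hz
    obtain ⟨ψ, hψ, h3, h4⟩ := hw
    have hφd := (contDiff_of_mem_smoothFunctions hφ).differentiable (by simp)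
    have hψd := (contDiff_of_mem_smoothFunctions hψ).differentiable (by simp)
    refine ⟨φ + ψ, ?_, ?_, ?_⟩
    · cases R with
      | dirichlet Ω =>
        exact ⟨hφ.1.add hψ.1, hφ.2.1.add hψ.2.1,
          (tsupport_add φ ψ).trans (union_subset hφ.2.2 hψ.2.2)⟩
      | periodic a b =>
        exact ⟨hφ.1.add hψ.1, fun i x => by simp [hφ.2 i x, hψ.2 i x]⟩
    · filter_upwards [Lp.coeFn_add z.fst w.fst, h1, h3] with x hx h1 h3
      rw [WithLp.add_fst, hx, Pi.add_apply, h1, h3, Pi.add_apply]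
    · filter_upwards [Lp.coeFn_add z.snd w.snd, h2, h4] with x hx h2 h4
      rw [WithLp.add_snd, hx, Pi.add_apply, h2, h4]
      simp [gradient, fderiv_add (hφd x) (hψd x)]
  | smul c z _ hz =>
    obtain ⟨φ, hφ, h1, h2⟩ := hz
    have hφd := (contDiff_of_mem_smoothFunctions hφ).differentiable (by simp)
    refine ⟨c • φ, ?_, ?_, ?_⟩
    · cases R with
      | dirichlet Ω =>
        refine ⟨hφ.1.const_smul c, hφ.2.1.mono fun x hx h => hx (by simp [h]), ?_⟩
        exact (closure_mono (Function.support_const_smul_subset c φ)).trans hφ.2.2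
      | periodic a b =>
        exact ⟨hφ.1.const_smul c, fun i x => by simp [hφ.2 i x]⟩
    · filter_upwards [Lp.coeFn_smul c z.fst, h1] with x hx h1
      rw [WithLp.smul_fst, hx, Pi.smul_apply, h1, Pi.smul_apply]
    · filter_upwards [Lp.coeFn_smul c z.snd, h2] with x hx h2
      rw [WithLp.smul_snd, hx, Pi.smul_apply, h2]
      simp [gradient, fderiv_const_smul (hφd x) c]

/-- The Sobolev embedding `X ⊆ L^q` in the subcritical and critical range. -/
theorem exists_eLpNorm_fn_le (hd : 1 ≤ d) (R : Region d) (hR : R.Admissible)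
    {q : ℝ≥0} (hq : 1 ≤ q) (hq' : 3 ≤ d → (1 / 2 : ℝ) - 1 / d ≤ 1 / q) :
    ∃ C : ℝ≥0, ∀ u : R.X, eLpNorm u.fn q R.meas ≤ C * ‖u‖ₑ := by
  obtain ⟨C, hC⟩ := exists_eLpNorm_le_of_mem_smoothFunctions hd R hR hq hq'
  have hsmooth (z : R.Pairs) (hz : z ∈ Submodule.span ℝ R.smoothPairs) :
      eLpNorm z.fst q R.meas ≤ (2 * C : ℝ≥0) * ‖z‖ₑ := by
    obtain ⟨φ, hφ, h1, h2⟩ := exists_smooth_of_mem_span hz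
    rw [eLpNorm_congr_ae h1]
    refine (hC φ hφ).trans ?_
    rw [← eLpNorm_congr_ae h1, ← eLpNorm_congr_ae h2, ← Lp.enorm_def, ← Lp.enorm_def]
    have h3 : ‖z.fst‖ₑ ≤ ‖z‖ₑ := enorm_le_iff_norm_le.2 (WithLp.norm_fst_le _ _)
    have h4 : ‖z.snd‖ₑ ≤ ‖z‖ₑ := enorm_le_iff_norm_le.2 (WithLp.norm_snd_le _ _)
    calc (C : ℝ≥0∞) * (‖z.fst‖ₑ + ‖z.snd‖ₑ) ≤ C * (‖z‖ₑ + ‖z‖ₑ) := by gcongr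
      _ = _ := by push_cast; ring
  refine ⟨2 * C * 2, fun u => ?_⟩
  rcases eq_or_ne u 0 with rfl | hu
  · have : X.fn (0 : R.X) =ᵐ[R.meas] 0 := Lp.coeFn_zero _ _ _
    rw [eLpNorm_congr_ae this]
    simp
  -- Smooth pairs converging to `u` have an a.e. convergent subsequence of first components, and
  -- Fatou's lemma passes the bound to the limit. Eventually `‖z n‖ < 2 ‖u‖`, which is why `u = 0`
  -- was treated apart.
  obtain ⟨z, hz, hzu⟩ := mem_closure_iff_seq_limit.1 (show u.1 ∈ closure _ from u.2)
  have hz1 : Filter.Tendsto (fun n => (z n).fst) Filter.atTop (nhds u.1.fst) :=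
    ((WithLp.fstL 2 ℝ (Lp ℝ 2 R.meas) (Lp (Space d) 2 R.meas)).continuous.tendsto _).comp hzu
  obtain ⟨ns, hns, hae⟩ := (tendstoInMeasure_of_tendsto_Lp hz1).exists_seq_tendsto_ae
  refine Lp.eLpNorm_le_of_ae_tendsto (u := Filter.atTop) (f := fun i => ((z (ns i)).fst : Space d → ℝ))
    ?_ (fun i => Lp.aestronglyMeasurable _) hae
  have hlt : ‖u.1‖ < 2 * ‖u.1‖ := by
    have : 0 < ‖u.1‖ := norm_pos_iff.2 (by simpa using hu)
    linarith
  filter_upwards [(hzu.comp hns.tendsto_atTop).norm.eventually_lt_const hlt] with i hi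
  refine (hsmooth _ (hz _)).trans ?_
  rw [ENNReal.coe_mul (2 * C), mul_assoc]
  gcongr
  rw [← ofReal_norm, ← ofReal_norm]
  calc ENNReal.ofReal ‖z (ns i)‖ ≤ ENNReal.ofReal (2 * ‖u.1‖) := ENNReal.ofReal_le_ofReal hi.le
    _ = _ := by rw [ENNReal.ofReal_mul (by norm_num)]; simp

end Region

/-! ### Pointwise expansions of powers. -/

section Pointwise

open Filter Asymptotics
open scoped Topology

theorem hasDerivAt_abs_rpow_add_one {p : ℝ} (hp : 1 < p) (s : ℝ) :
    HasDerivAt (fun s : ℝ => |s| ^ (p + 1)) ((p + 1) * (|s| ^ (p - 1) * s)) s := by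
  have h := hasDerivAt_abs_rpow s (p := p + 1) (by linarith)
  rw [show p + 1 - 2 = p - 1 by ring, mul_assoc] at h
  exact h

theorem hasDerivAt_abs_rpow_mul_self {p : ℝ} (hp : 1 < p) (s : ℝ) :
    HasDerivAt (fun s : ℝ => |s| ^ (p - 1) * s) (p * |s| ^ (p - 1)) s := by
  rcases eq_or_ne s 0 with rfl | hs
  · rw [abs_zero, Real.zero_rpow (by linarith), mul_zero, hasDerivAt_iff_isLittleO]
    have h1 : Tendsto (fun t : ℝ => |t| ^ (p - 1)) (𝓝 0) (𝓝 0) := by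
      have : Continuous fun t : ℝ => |t| ^ (p - 1) :=
        continuous_abs.rpow_const fun _ => Or.inr (by linarith)
      simpa [Real.zero_rpow (show p - 1 ≠ 0 by linarith)] using this.tendsto 0
    have h2 := ((isLittleO_one_iff ℝ).2 h1).mul_isBigO (isBigO_refl (fun t : ℝ => t) (𝓝 0))
    simpa using h2
  · have ha : HasDerivAt (fun s : ℝ => |s|) (SignType.sign s : ℝ) s := hasDerivAt_abs hs
    have h := (ha.rpow_const (p := p - 1) (Or.inl (abs_ne_zero.2 hs))).mul (hasDerivAt_id s)
    refine h.congr_deriv ?_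
    have h3 : |s| ^ (p - 1 - 1) * |s| = |s| ^ (p - 1) := by
      rw [← Real.rpow_add_one (abs_ne_zero.2 hs)]
      ring_nf
    have h4 : (SignType.sign s : ℝ) * s = |s| := by
      rw [sign_mul_self]
    simp only [id, mul_one]
    linear_combination (p - 1) * |s| ^ (p - 1 - 1) * h4 + (p - 1) * h3

/-- Mean value inequality on the segment from `0` to `t`, where `g'` is `o(t)`. The second
derivative is needed at `0` only, so powers with `p < 2` are covered. -/
theorem isLittleO_sq_of_hasDerivAt {g g' : ℝ → ℝ} (h0 : g 0 = 0) (h0' : g' 0 = 0)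
    (hg : ∀ t, HasDerivAt g (g' t) t) (hg' : HasDerivAt g' 0 0) :
    g =o[𝓝 0] fun t => t ^ 2 := by
  refine isLittleO_iff.2 fun c hc => ?_
  have h1 : g' =o[𝓝 0] fun t => t := by simpa [hasDerivAt_iff_isLittleO, h0'] using hg'
  obtain ⟨δ, hδ, hball⟩ := Metric.eventually_nhds_iff_ball.1 (isLittleO_iff.1 h1 hc)
  filter_upwards [Metric.ball_mem_nhds 0 hδ] with t ht
  have h2 : ∀ s ∈ segment ℝ 0 t, ‖g' s‖ ≤ c * ‖t‖ := by
    intro s hs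
    have hst : ‖s‖ ≤ ‖t‖ := by
      obtain ⟨a, b, ha, hb, hab, rfl⟩ := hs
      simp only [smul_zero, zero_add, norm_smul, Real.norm_eq_abs, abs_of_nonneg hb]
      exact mul_le_of_le_one_left (abs_nonneg _) (by linarith)
    have hs' : s ∈ Metric.ball (0 : ℝ) δ := by
      rw [mem_ball_zero_iff] at ht ⊢
      exact hst.trans_lt ht
    exact (hball s hs').trans (by gcongr)
  have h3 := (convex_segment (0 : ℝ) t).norm_image_sub_le_of_norm_hasDerivWithin_le
    (fun s _ => (hg s).hasDerivWithinAt) h2 (left_mem_segment ℝ 0 t) (right_mem_segment ℝ 0 t)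
  rw [h0, sub_zero, sub_zero] at h3
  rw [norm_pow]
  linarith [h3, show c * ‖t‖ ^ 2 = c * ‖t‖ * ‖t‖ by ring]

/-- The `o(t²)` bound serves near `0`; away from it `1 + |t|` is at most a multiple of `|t|`, so the
growth bound is absorbed by `|t|^(p+1)`. -/
theorem exists_abs_le_sq_add_rpow {p : ℝ} (hp : 1 < p) {g : ℝ → ℝ}
    (h0 : g =o[𝓝 0] fun t => t ^ 2) {K : ℝ} (hK : ∀ t, |g t| ≤ K * (1 + |t|) ^ (p + 1))
    {ε : ℝ} (hε : 0 < ε) :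
    ∃ C, 0 ≤ C ∧ ∀ t, |g t| ≤ ε * t ^ 2 + C * |t| ^ (p + 1) := by
  obtain ⟨δ, hδ, hball⟩ := Metric.eventually_nhds_iff_ball.1 (isLittleO_iff.1 h0 hε)
  have hK0 : 0 ≤ K := by
    have := (abs_nonneg _).trans (hK 0)
    simpa using this
  refine ⟨K * (δ⁻¹ + 1) ^ (p + 1), by positivity, fun t => ?_⟩
  rcases lt_or_ge |t| δ with ht | ht
  · have h := hball t (by simpa using ht)
    rw [Real.norm_eq_abs, norm_pow, Real.norm_eq_abs, sq_abs] at h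
    exact h.trans (le_add_of_nonneg_right (by positivity))
  · refine (hK t).trans (le_add_of_nonneg_of_le (by positivity) ?_)
    rw [mul_assoc, ← Real.mul_rpow (by positivity) (by positivity)]
    gcongr
    have : 1 ≤ δ⁻¹ * |t| := by
      rw [inv_mul_eq_div, one_le_div hδ]
      exact ht
    linarith

theorem abs_rpow_add_one_eq (p : ℝ) (hp : 1 < p) (x : ℝ) :
    |x| ^ (p + 1) = |x| ^ (p - 1) * x ^ 2 := by
  rcases eq_or_ne x 0 with rfl | hx
  · simp [Real.zero_rpow (show p + 1 ≠ 0 by linarith)]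
  · rw [← sq_abs x, ← Real.rpow_natCast, ← Real.rpow_add (abs_pos.2 hx)]
    norm_num
    ring_nf

/-- Homogeneity of degree `p + 1` reduces the two-variable estimate to the single function `r 1`,
through `ξ = x t`; only `x = 0` escapes the scaling. -/
theorem exists_abs_le_of_homogeneous {p : ℝ} (hp : 1 < p) {r : ℝ → ℝ → ℝ}
    (hr : ∀ x t, x ≠ 0 → r x (x * t) = |x| ^ (p + 1) * r 1 t)
    (hr0 : ∀ ξ, |r 0 ξ| ≤ |ξ| ^ (p + 1))
    (h0 : r 1 =o[𝓝 0] fun t => t ^ 2) {K : ℝ} (hK : ∀ t, |r 1 t| ≤ K * (1 + |t|) ^ (p + 1))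
    {ε : ℝ} (hε : 0 < ε) :
    ∃ C, 0 ≤ C ∧ ∀ x ξ, |r x ξ| ≤ ε * (|x| ^ (p - 1) * ξ ^ 2) + C * |ξ| ^ (p + 1) := by
  obtain ⟨C, hC0, hC⟩ := exists_abs_le_sq_add_rpow hp h0 hK hε
  refine ⟨C + 1, by positivity, fun x ξ => ?_⟩
  have hξ : 0 ≤ |ξ| ^ (p + 1) := by positivity
  rcases eq_or_ne x 0 with rfl | hx
  · refine (hr0 ξ).trans ?_
    have : 0 ≤ ε * (|(0 : ℝ)| ^ (p - 1) * ξ ^ 2) := by positivity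
    nlinarith
  · obtain ⟨t, rfl⟩ : ∃ t, ξ = x * t := ⟨ξ / x, by field_simp⟩
    have hx2 := abs_rpow_add_one_eq p hp x
    have hxt : |x * t| ^ (p + 1) = |x| ^ (p + 1) * |t| ^ (p + 1) := by
      rw [abs_mul, Real.mul_rpow (abs_nonneg _) (abs_nonneg _)]
    rw [hr x t hx, abs_mul, abs_of_nonneg (by positivity)]
    have h := mul_le_mul_of_nonneg_left (hC t) (show 0 ≤ |x| ^ (p + 1) by positivity)
    rw [hxt] at hξ ⊢
    have e : ε * (|x| ^ (p - 1) * (x * t) ^ 2) = |x| ^ (p + 1) * (ε * t ^ 2) := by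
      rw [hx2]; ring
    rw [e]
    linarith

theorem rpow_le_one_add_rpow {t s r : ℝ} (hs : 0 ≤ s) (hsr : s ≤ r) :
    |t| ^ s ≤ (1 + |t|) ^ r :=
  (Real.rpow_le_rpow (abs_nonneg t) (by linarith) hs).trans
    (Real.rpow_le_rpow_of_exponent_le (by linarith [abs_nonneg t]) hsr)

/-- Second order Taylor expansion of `|x| ^ (p + 1)`. -/
theorem exists_taylor_abs_rpow {p : ℝ} (hp : 1 < p) {ε : ℝ} (hε : 0 < ε) :
    ∃ C, 0 ≤ C ∧ ∀ x ξ : ℝ,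
      |(|x + ξ| ^ (p + 1) - |x| ^ (p + 1) - (p + 1) * (|x| ^ (p - 1) * x * ξ)
        - (p + 1) * p / 2 * (|x| ^ (p - 1) * ξ ^ 2))|
      ≤ ε * (|x| ^ (p - 1) * ξ ^ 2) + C * |ξ| ^ (p + 1) := by
  refine exists_abs_le_of_homogeneous hp (r := fun x ξ => |x + ξ| ^ (p + 1) - |x| ^ (p + 1)
    - (p + 1) * (|x| ^ (p - 1) * x * ξ) - (p + 1) * p / 2 * (|x| ^ (p - 1) * ξ ^ 2))
    (K := 2 + (p + 1) + (p + 1) * p / 2) ?_ ?_ ?_ ?_ hε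
  · intro x t hx
    have h1 : |x + x * t| ^ (p + 1) = |x| ^ (p + 1) * |1 + t| ^ (p + 1) := by
      rw [show x + x * t = x * (1 + t) by ring, abs_mul,
        Real.mul_rpow (abs_nonneg _) (abs_nonneg _)]
    simp only [h1, abs_one, Real.one_rpow]
    rw [abs_rpow_add_one_eq p hp x]
    ring
  · intro ξ
    simp [Real.zero_rpow (show p + 1 ≠ 0 by linarith), Real.zero_rpow (show p - 1 ≠ 0 by linarith),
      abs_of_nonneg (show 0 ≤ |ξ| ^ (p + 1) by positivity)]
  · simp only [abs_one, Real.one_rpow]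
    refine isLittleO_sq_of_hasDerivAt
      (g' := fun t => (p + 1) * (|1 + t| ^ (p - 1) * (1 + t)) - (p + 1) - (p + 1) * p * t)
      (by simp) (by simp) (fun t => ?_) ?_
    · have h := (hasDerivAt_abs_rpow_add_one hp (1 + t)).comp t
        ((hasDerivAt_id t).const_add (1 : ℝ))
      refine (((h.sub_const 1).sub (((hasDerivAt_id t).const_mul (1 * 1)).const_mul (p + 1))).sub
        ((((hasDerivAt_id t).pow 2).const_mul 1).const_mul ((p + 1) * p / 2))).congr_deriv ?_
      simp
      ring
    · have h := (hasDerivAt_abs_rpow_mul_self hp (1 + 0)).comp (0 : ℝ)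
        ((hasDerivAt_id (0 : ℝ)).const_add (1 : ℝ))
      refine (((h.const_mul (p + 1)).sub_const (p + 1)).sub
        ((hasDerivAt_id (0 : ℝ)).const_mul ((p + 1) * p))).congr_deriv ?_
      simp
  · intro t
    simp only [abs_one, Real.one_rpow, one_mul]
    have h0 : |1 + t| ^ (p + 1) ≤ (1 + |t|) ^ (p + 1) :=
      Real.rpow_le_rpow (abs_nonneg _) ((abs_add_le _ _).trans (by simp)) (by linarith)
    have h1 : 1 ≤ (1 + |t|) ^ (p + 1) := by
      simpa using rpow_le_one_add_rpow (t := t) le_rfl (show 0 ≤ p + 1 by linarith)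
    have h2 : |t| ≤ (1 + |t|) ^ (p + 1) := by
      simpa using rpow_le_one_add_rpow (t := t) zero_le_one (show 1 ≤ p + 1 by linarith)
    have h3 : t ^ 2 ≤ (1 + |t|) ^ (p + 1) := by
      simpa using rpow_le_one_add_rpow (t := t) zero_le_two (show 2 ≤ p + 1 by linarith)
    have h4 : 0 ≤ |1 + t| ^ (p + 1) := by positivity
    generalize (1 + |t|) ^ (p + 1) = A at *
    have h5 := mul_le_mul_of_nonneg_left h2 (show 0 ≤ p + 1 by linarith)
    have h6 := mul_le_mul_of_nonneg_left h3 (show 0 ≤ (p + 1) * p / 2 by positivity)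
    refine (abs_sub _ _).trans ((add_le_add_left (abs_sub _ _) _).trans
      ((add_le_add_left (add_le_add_left (abs_sub _ _) _) _).trans ?_))
    rw [abs_mul, abs_mul ((p + 1) * p / 2), abs_of_nonneg h4, abs_one,
      abs_of_nonneg (show 0 ≤ p + 1 by linarith), abs_of_nonneg (sq_nonneg t),
      abs_of_nonneg (show 0 ≤ (p + 1) * p / 2 by positivity)]
    linarith

/-- The form `|y| ^ (p - 1) * y * x` is symmetric in `(x, y)` to second order, up to a multiple of
`|y| ^ (p + 1) - |x| ^ (p + 1)`. -/
theorem exists_abs_rpow_mul_antisymm_le {p : ℝ} (hp : 1 < p) {ε : ℝ} (hε : 0 < ε) :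
    ∃ C, 0 ≤ C ∧ ∀ x ξ : ℝ,
      |(|x + ξ| ^ (p - 1) * (x + ξ) * x - |x| ^ (p - 1) * x * (x + ξ)
        - (p - 1) / (p + 1) * (|x + ξ| ^ (p + 1) - |x| ^ (p + 1)))|
      ≤ ε * (|x| ^ (p - 1) * ξ ^ 2) + C * |ξ| ^ (p + 1) := by
  have hκ0 : 0 ≤ (p - 1) / (p + 1) := div_nonneg (by linarith) (by linarith)
  have hκ1 : (p - 1) / (p + 1) ≤ 1 := by rw [div_le_one (by linarith)]; linarith
  have hκ : (p - 1) / (p + 1) * (p + 1) = p - 1 := by field_simp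
  -- At `x = 1` this one value cancels both the first order term, `p - 1 - κ(p+1)`, and the second
  -- order term, `p(p-1) - κ(p+1)p`.
  set κ := (p - 1) / (p + 1)
  refine exists_abs_le_of_homogeneous hp (r := fun x ξ => |x + ξ| ^ (p - 1) * (x + ξ) * x
    - |x| ^ (p - 1) * x * (x + ξ) - κ * (|x + ξ| ^ (p + 1) - |x| ^ (p + 1)))
    (K := 4) ?_ ?_ ?_ ?_ hε
  · intro x t hx
    have h1 (s : ℝ) : |x + x * t| ^ s = |x| ^ s * |1 + t| ^ s := by
      rw [show x + x * t = x * (1 + t) by ring, abs_mul,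
        Real.mul_rpow (abs_nonneg _) (abs_nonneg _)]
    simp only [h1, abs_one, Real.one_rpow]
    rw [abs_rpow_add_one_eq p hp x]
    ring
  · intro ξ
    have : 0 ≤ |ξ| ^ (p + 1) := by positivity
    simp only [zero_add, mul_zero, abs_zero, zero_mul, sub_zero,
      Real.zero_rpow (show p + 1 ≠ 0 by linarith), zero_sub, abs_neg, abs_mul, abs_of_nonneg hκ0,
      abs_of_nonneg this]
    exact mul_le_of_le_one_left this hκ1
  · simp only [abs_one, Real.one_rpow]
    refine isLittleO_sq_of_hasDerivAt
      (g' := fun t => p * |1 + t| ^ (p - 1) - 1 - (p - 1) * (|1 + t| ^ (p - 1) * (1 + t)))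
      (by simp) (by simp) (fun t => ?_) ?_
    · have h := (hasDerivAt_abs_rpow_add_one hp (1 + t)).comp t
        ((hasDerivAt_id t).const_add (1 : ℝ))
      have h' := (hasDerivAt_abs_rpow_mul_self hp (1 + t)).comp t
        ((hasDerivAt_id t).const_add (1 : ℝ))
      refine (((h'.mul_const 1).sub (((hasDerivAt_id t).const_add 1).const_mul (1 * 1))).sub
        ((h.sub_const 1).const_mul κ)).congr_deriv ?_
      simp only [mul_one]
      linear_combination -(|1 + t| ^ (p - 1) * (1 + t)) * hκ
    · have h := (hasDerivAt_abs_rpow_mul_self hp (1 + 0)).comp (0 : ℝ)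
        ((hasDerivAt_id (0 : ℝ)).const_add (1 : ℝ))
      have ha : HasDerivAt (fun s : ℝ => |s|) (1 : ℝ) (1 + 0) := by
        simpa using hasDerivAt_abs (x := (1 : ℝ) + 0) (by norm_num)
      have h' := (ha.rpow_const (p := p - 1) (Or.inl (by norm_num))).comp (0 : ℝ)
        ((hasDerivAt_id (0 : ℝ)).const_add (1 : ℝ))
      refine (((h'.const_mul p).sub_const 1).sub (h.const_mul (p - 1))).congr_deriv ?_
      simp
      ring
  · intro t
    simp only [abs_one, Real.one_rpow, one_mul, mul_one]
    have h00 : |1 + t| ≤ 1 + |t| := (abs_add_le _ _).trans (by simp)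
    have h0 : |1 + t| ^ (p + 1) ≤ (1 + |t|) ^ (p + 1) :=
      Real.rpow_le_rpow (abs_nonneg _) h00 (by linarith)
    have h1 : 1 ≤ (1 + |t|) ^ (p + 1) := by
      simpa using rpow_le_one_add_rpow (t := t) le_rfl (show 0 ≤ p + 1 by linarith)
    have h4 : 0 ≤ |1 + t| ^ (p + 1) := by positivity
    have h6 : 1 + |t| ≤ (1 + |t|) ^ (p + 1) := by
      conv_lhs => rw [← Real.rpow_one (1 + |t|)]
      exact Real.rpow_le_rpow_of_exponent_le (by linarith [abs_nonneg t]) (by linarith)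
    have h5 : |1 + t| ^ (p - 1) * |1 + t| ≤ (1 + |t|) ^ (p + 1) := by
      calc |1 + t| ^ (p - 1) * |1 + t| ≤ (1 + |t|) ^ (p - 1) * (1 + |t|) := by gcongr
        _ = (1 + |t|) ^ p := by
            rw [← Real.rpow_add_one (by positivity)]; ring_nf
        _ ≤ _ := Real.rpow_le_rpow_of_exponent_le (by linarith [abs_nonneg t]) (by linarith)
    have h7 : |κ * (|1 + t| ^ (p + 1) - 1)| ≤ 2 * (1 + |t|) ^ (p + 1) := by
      rw [abs_mul, abs_of_nonneg hκ0]
      refine (mul_le_of_le_one_left (abs_nonneg _) hκ1).trans ((abs_sub _ _).trans ?_)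
      rw [abs_of_nonneg h4, abs_one]
      linarith
    refine (abs_sub _ _).trans ((add_le_add_left (abs_sub _ _) _).trans ?_)
    rw [abs_mul, abs_of_nonneg (show 0 ≤ |1 + t| ^ (p - 1) by positivity)]
    linarith

end Pointwise

theorem eq_zero_of_forall_nonneg_quadratic {b c : ℝ} (h : ∀ t : ℝ, 0 ≤ 2 * b * t + c * t ^ 2) :
    b = 0 := by
  by_contra hb
  have hb2 : 0 < b ^ 2 := by positivity
  have hc : 0 < |c| + 1 := by positivity
  -- The test point has the sign opposite to `b` and is short enough for the linear term to beat the
  -- quadratic one.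
  have h1 := h (-b / (|c| + 1))
  have h2 : 2 * b * (-b / (|c| + 1)) + c * (-b / (|c| + 1)) ^ 2 =
      (-2 * (|c| + 1) + c) * (b ^ 2 / (|c| + 1) ^ 2) := by field_simp
  rw [h2] at h1
  have h3 : 0 < b ^ 2 / (|c| + 1) ^ 2 := by positivity
  have h4 : -2 * (|c| + 1) + c < 0 := by linarith [le_abs_self c, abs_nonneg c]
  exact absurd h1 (not_le.2 (mul_neg_of_neg_of_pos h4 h3))

/-! ### Integrated expansions and differentiation under the integral. -/

section Integrals

variable {Y : Type*} [MeasurableSpace Y] {μ : Measure Y} {p : ℝ} {f g h : Y → ℝ}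

theorem integrable_abs_rpow (hp : 1 < p) (hf : MemLp f (ENNReal.ofReal (p + 1)) μ) :
    Integrable (fun x => |f x| ^ (p + 1)) μ := by
  have h := hf.integrable_norm_rpow
    (by rw [Ne, ENNReal.ofReal_eq_zero]; linarith) ENNReal.ofReal_ne_top
  rwa [ENNReal.toReal_ofReal (by linarith)] at h

theorem aestronglyMeasurable_abs_rpow (hf : AEStronglyMeasurable f μ) (s : ℝ) :
    AEStronglyMeasurable (fun x => |f x| ^ s) μ :=
  (hf.aemeasurable.abs.pow_const s).aestronglyMeasurable

theorem integrable_abs_rpow_mul (hp : 1 < p) (hf : MemLp f (ENNReal.ofReal (p + 1)) μ)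
    (hg : MemLp g (ENNReal.ofReal (p + 1)) μ) {s t : ℝ} (hs : 0 ≤ s) (ht : 0 ≤ t)
    (hst : s + t = p + 1) : Integrable (fun x => |f x| ^ s * |g x| ^ t) μ := by
  refine ((integrable_abs_rpow hp hf).add (integrable_abs_rpow hp hg)).mono'
    ((aestronglyMeasurable_abs_rpow hf.1 s).mul (aestronglyMeasurable_abs_rpow hg.1 t))
    (Filter.Eventually.of_forall fun x => ?_)
  rw [Real.norm_of_nonneg (by positivity), Pi.add_apply]
  have hm : 0 ≤ max |f x| |g x| := (abs_nonneg _).trans (le_max_left _ _)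
  calc |f x| ^ s * |g x| ^ t ≤ max |f x| |g x| ^ s * max |f x| |g x| ^ t := by
        gcongr
        · exact le_max_left _ _
        · exact le_max_right _ _
    _ = max |f x| |g x| ^ (p + 1) := by rw [← Real.rpow_add_of_nonneg hm hs ht, hst]
    _ ≤ |f x| ^ (p + 1) + |g x| ^ (p + 1) := by
        rcases max_choice |f x| |g x| with h | h <;> rw [h]
        · exact le_add_of_nonneg_right (by positivity)
        · exact le_add_of_nonneg_left (by positivity)

theorem memLp_abs_rpow (hp : 1 < p) (hf : MemLp f (ENNReal.ofReal (p + 1)) μ) {s : ℝ}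
    (hs : 0 < s) : MemLp (fun x => |f x| ^ s) (ENNReal.ofReal ((p + 1) / s)) μ := by
  have hq : 0 < (p + 1) / s := div_pos (by linarith) hs
  rw [← integrable_norm_rpow_iff (aestronglyMeasurable_abs_rpow hf.1 s)
    (by rwa [Ne, ENNReal.ofReal_eq_zero, not_le]) ENNReal.ofReal_ne_top,
    ENNReal.toReal_ofReal hq.le]
  refine (integrable_abs_rpow hp hf).congr (Filter.Eventually.of_forall fun x => ?_)
  simp only [Real.norm_of_nonneg (show 0 ≤ |f x| ^ s by positivity)]
  rw [← Real.rpow_mul (abs_nonneg _), mul_div_cancel₀ _ hs.ne']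

theorem integral_abs_rpow_mul_le (hp : 1 < p) (hf : MemLp f (ENNReal.ofReal (p + 1)) μ)
    (hg : MemLp g (ENNReal.ofReal (p + 1)) μ) {s t : ℝ} (hs : 0 < s) (ht : 0 < t)
    (hst : s + t = p + 1) :
    ∫ x, |f x| ^ s * |g x| ^ t ∂μ ≤
      (∫ x, |f x| ^ (p + 1) ∂μ) ^ (s / (p + 1)) * (∫ x, |g x| ^ (p + 1) ∂μ) ^ (t / (p + 1)) := by
  have hconj : ((p + 1) / s).HolderConjugate ((p + 1) / t) := by
    rw [Real.holderConjugate_iff]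
    refine ⟨?_, ?_⟩
    · rw [one_lt_div hs]; linarith
    · rw [inv_div, inv_div, ← add_div, hst, div_self (by linarith)]
  have h := integral_mul_le_Lp_mul_Lq_of_nonneg (μ := μ) hconj (f := fun x => |f x| ^ s)
    (g := fun x => |g x| ^ t) (Filter.Eventually.of_forall fun x => by positivity)
    (Filter.Eventually.of_forall fun x => by positivity) (memLp_abs_rpow hp hf hs)
    (memLp_abs_rpow hp hg ht)
  simp_rw [← Real.rpow_mul (abs_nonneg _), mul_div_cancel₀ _ hs.ne', mul_div_cancel₀ _ ht.ne',
    one_div_div] at h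
  exact h

theorem integrable_abs_rpow_mul_mul (hp : 1 < p) (hf : MemLp f (ENNReal.ofReal (p + 1)) μ)
    (hg : MemLp g (ENNReal.ofReal (p + 1)) μ) :
    Integrable (fun x => |f x| ^ (p - 1) * f x * g x) μ := by
  refine (integrable_abs_rpow_mul hp hf hg (s := p) (t := 1) (by linarith) zero_le_one rfl).mono
    (((aestronglyMeasurable_abs_rpow hf.1 _).mul hf.1).mul hg.1)
    (Filter.Eventually.of_forall fun x => ?_)
  rw [norm_mul, norm_mul, Real.norm_of_nonneg (show 0 ≤ |f x| ^ (p - 1) by positivity),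
    Real.norm_of_nonneg (show 0 ≤ |f x| ^ p * |g x| ^ (1 : ℝ) by positivity), Real.rpow_one,
    Real.norm_eq_abs, Real.norm_eq_abs]
  refine le_of_eq ?_
  congr 1
  conv_rhs => rw [show p = p - 1 + 1 by ring]
  rw [Real.rpow_add_one' (abs_nonneg _) (by linarith)]

theorem integrable_abs_rpow_mul_sq (hp : 1 < p) (hf : MemLp f (ENNReal.ofReal (p + 1)) μ)
    (hg : MemLp g (ENNReal.ofReal (p + 1)) μ) :
    Integrable (fun x => |f x| ^ (p - 1) * g x ^ 2) μ := by
  have h := integrable_abs_rpow_mul hp hf hg (s := p - 1) (t := 2) (by linarith) zero_le_two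
    (by ring)
  simpa using h

/-- Hölder's inequality for the derivative of the `L^{p+1}` norm. -/
theorem abs_integral_abs_rpow_mul_mul_le (hp : 1 < p) (hf : MemLp f (ENNReal.ofReal (p + 1)) μ)
    (hg : MemLp g (ENNReal.ofReal (p + 1)) μ) :
    |∫ x, |f x| ^ (p - 1) * f x * g x ∂μ| ≤
      (∫ x, |f x| ^ (p + 1) ∂μ) ^ (p / (p + 1)) * (∫ x, |g x| ^ (p + 1) ∂μ) ^ (1 / (p + 1)) := by
  refine abs_integral_le_integral_abs.trans ?_
  refine le_trans (le_of_eq (integral_congr_ae (Filter.Eventually.of_forall fun x => ?_)))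
    (integral_abs_rpow_mul_le hp hf hg (s := p) (t := 1) (by linarith) zero_lt_one rfl)
  simp only [abs_mul, abs_of_nonneg (show 0 ≤ |f x| ^ (p - 1) by positivity), Real.rpow_one]
  congr 1
  conv_rhs => rw [show p = p - 1 + 1 by ring]
  rw [Real.rpow_add_one' (abs_nonneg _) (by linarith)]

theorem integral_abs_rpow_mul_sq_le (hp : 1 < p) (hf : MemLp f (ENNReal.ofReal (p + 1)) μ)
    (hg : MemLp g (ENNReal.ofReal (p + 1)) μ) :
    ∫ x, |f x| ^ (p - 1) * g x ^ 2 ∂μ ≤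
      (∫ x, |f x| ^ (p + 1) ∂μ) ^ ((p - 1) / (p + 1)) *
        (∫ x, |g x| ^ (p + 1) ∂μ) ^ (2 / (p + 1)) := by
  have h := integral_abs_rpow_mul_le hp hf hg (s := p - 1) (t := 2) (by linarith) zero_lt_two
    (by ring)
  simpa using h

theorem exists_integral_taylor (hp : 1 < p) {ε : ℝ} (hε : 0 < ε) :
    ∃ C, 0 ≤ C ∧ ∀ f g : Y → ℝ, MemLp f (ENNReal.ofReal (p + 1)) μ →
      MemLp g (ENNReal.ofReal (p + 1)) μ →
      |∫ x, |f x + g x| ^ (p + 1) ∂μ - ∫ x, |f x| ^ (p + 1) ∂μ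
        - (p + 1) * ∫ x, |f x| ^ (p - 1) * f x * g x ∂μ
        - (p + 1) * p / 2 * ∫ x, |f x| ^ (p - 1) * g x ^ 2 ∂μ| ≤
      ε * ∫ x, |f x| ^ (p - 1) * g x ^ 2 ∂μ + C * ∫ x, |g x| ^ (p + 1) ∂μ := by
  obtain ⟨C, hC0, hC⟩ := exists_taylor_abs_rpow hp hε
  refine ⟨C, hC0, fun f g hf hg => ?_⟩
  have h1 := integrable_abs_rpow hp (hf.add hg)
  simp only [Pi.add_apply] at h1
  have h2 := integrable_abs_rpow hp hf
  have h3 := (integrable_abs_rpow_mul_mul hp hf hg).const_mul (p + 1)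
  have h4 := integrable_abs_rpow_mul_sq hp hf hg
  have h4' := h4.const_mul ((p + 1) * p / 2)
  have h5 := integrable_abs_rpow hp hg
  have h12 : Integrable (fun x => |f x + g x| ^ (p + 1) - |f x| ^ (p + 1)) μ := h1.sub h2
  have h123 : Integrable (fun x => |f x + g x| ^ (p + 1) - |f x| ^ (p + 1)
    - (p + 1) * (|f x| ^ (p - 1) * f x * g x)) μ := h12.sub h3
  rw [← integral_const_mul, ← integral_const_mul, ← integral_sub h1 h2, ← integral_sub h12 h3,
    ← integral_sub h123 h4', ← integral_const_mul, ← integral_const_mul,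
    ← integral_add (h4.const_mul ε) (h5.const_mul C)]
  refine abs_integral_le_integral_abs.trans (integral_mono_of_nonneg
    (Filter.Eventually.of_forall fun x => abs_nonneg _) ((h4.const_mul ε).add (h5.const_mul C))
    (Filter.Eventually.of_forall fun x => hC (f x) (g x)))

/-- Equality of the two `L^{p+1}` norms makes the correction term of the pointwise estimate
integrate to zero. -/
theorem exists_integral_antisymm_le (hp : 1 < p) {ε : ℝ} (hε : 0 < ε) :
    ∃ C, 0 ≤ C ∧ ∀ f g : Y → ℝ, MemLp f (ENNReal.ofReal (p + 1)) μ →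
      MemLp g (ENNReal.ofReal (p + 1)) μ →
      ∫ x, |f x + g x| ^ (p + 1) ∂μ = ∫ x, |f x| ^ (p + 1) ∂μ →
      |∫ x, |f x + g x| ^ (p - 1) * (f x + g x) * f x ∂μ
        - ∫ x, |f x| ^ (p - 1) * f x * (f x + g x) ∂μ| ≤
      ε * ∫ x, |f x| ^ (p - 1) * g x ^ 2 ∂μ + C * ∫ x, |g x| ^ (p + 1) ∂μ := by
  obtain ⟨C, hC0, hC⟩ := exists_abs_rpow_mul_antisymm_le hp hε
  refine ⟨C, hC0, fun f g hf hg heq => ?_⟩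
  have hfg := hf.add hg
  have h1 := integrable_abs_rpow hp hfg
  have h2 := integrable_abs_rpow hp hf
  have h3 := integrable_abs_rpow_mul_mul hp hfg hf
  have h3' := integrable_abs_rpow_mul_mul hp hf hfg
  simp only [Pi.add_apply] at h1 h3 h3'
  have h4 := integrable_abs_rpow_mul_sq hp hf hg
  have h5 := integrable_abs_rpow hp hg
  have h12 : Integrable (fun x => |f x + g x| ^ (p + 1) - |f x| ^ (p + 1)) μ := h1.sub h2
  have h33 : Integrable (fun x => |f x + g x| ^ (p - 1) * (f x + g x) * f x
    - |f x| ^ (p - 1) * f x * (f x + g x)) μ := h3.sub h3'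
  have h0 : (p - 1) / (p + 1) * (∫ x, |f x + g x| ^ (p + 1) ∂μ - ∫ x, |f x| ^ (p + 1) ∂μ) = 0 := by
    rw [heq, sub_self, mul_zero]
  rw [← sub_zero (_ - _), ← h0, ← integral_sub h1 h2, ← integral_const_mul, ← integral_sub h3 h3',
    ← integral_sub h33 (h12.const_mul _), ← integral_const_mul,
    ← integral_const_mul, ← integral_add (h4.const_mul ε) (h5.const_mul C)]
  refine abs_integral_le_integral_abs.trans (integral_mono_of_nonneg
    (Filter.Eventually.of_forall fun x => abs_nonneg _) ((h4.const_mul ε).add (h5.const_mul C))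
    (Filter.Eventually.of_forall fun x => hC (f x) (g x)))

theorem abs_add_mul_le_of_mem_ball {a b t t₀ : ℝ} (ht : t ∈ Metric.ball t₀ 1) :
    |a + t * b| ≤ |a| + (|t₀| + 1) * |b| := by
  have h : |t| ≤ |t₀| + 1 := by
    rw [Metric.mem_ball, Real.dist_eq] at ht
    have := abs_sub_abs_le_abs_sub t t₀
    linarith
  refine (abs_add_le _ _).trans ?_
  rw [abs_mul]
  gcongr

theorem hasDerivAt_integral_abs_rpow (hp : 1 < p) (hf : MemLp f (ENNReal.ofReal (p + 1)) μ)
    (hg : MemLp g (ENNReal.ofReal (p + 1)) μ) (t₀ : ℝ) :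
    HasDerivAt (fun t => ∫ x, |f x + t * g x| ^ (p + 1) ∂μ)
      ((p + 1) * ∫ x, |f x + t₀ * g x| ^ (p - 1) * (f x + t₀ * g x) * g x ∂μ) t₀ := by
  have hm (t : ℝ) : MemLp (fun x => f x + t * g x) (ENNReal.ofReal (p + 1)) μ :=
    hf.add (hg.const_mul t)
  have hb : MemLp (fun x => |f x| + (|t₀| + 1) * |g x|) (ENNReal.ofReal (p + 1)) μ :=
    hf.abs.add (hg.abs.const_mul _)
  rw [← integral_const_mul]
  refine (hasDerivAt_integral_of_dominated_loc_of_deriv_le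
    (F' := fun t x => (p + 1) * (|f x + t * g x| ^ (p - 1) * (f x + t * g x) * g x))
    -- For `t` within distance one of `t₀`, `|f + t g|` is at most `|f| + (|t₀| + 1)|g|`, which lies
    -- in `L^{p+1}`.
    (bound := fun x => (p + 1) * ((|f x| + (|t₀| + 1) * |g x|) ^ p * |g x|))
    (Metric.ball_mem_nhds t₀ zero_lt_one)
    (Filter.Eventually.of_forall fun t => (integrable_abs_rpow hp (hm t)).1)
    (integrable_abs_rpow hp (hm t₀))
    ((integrable_abs_rpow_mul_mul hp (hm t₀) hg).const_mul _).1 ?_ ?_ ?_).2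
  · refine Filter.Eventually.of_forall fun x t ht => ?_
    rw [norm_mul, norm_mul, norm_mul, Real.norm_of_nonneg (show 0 ≤ p + 1 by linarith),
      Real.norm_of_nonneg (show 0 ≤ |f x + t * g x| ^ (p - 1) by positivity), Real.norm_eq_abs,
      Real.norm_eq_abs]
    have h1 : |f x + t * g x| ^ (p - 1) * |f x + t * g x| = |f x + t * g x| ^ p := by
      conv_rhs => rw [show p = p - 1 + 1 by ring]
      rw [Real.rpow_add_one' (abs_nonneg _) (by linarith)]
    rw [h1]
    gcongr
    exact abs_add_mul_le_of_mem_ball ht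
  · have h := integrable_abs_rpow_mul hp hb hg (s := p) (t := 1) (by linarith) zero_le_one rfl
    refine (h.const_mul (p + 1)).congr (Filter.Eventually.of_forall fun x => ?_)
    simp only [Real.rpow_one]
    rw [abs_of_nonneg (show 0 ≤ |f x| + (|t₀| + 1) * |g x| by positivity)]
  · refine Filter.Eventually.of_forall fun x t _ => ?_
    have h := (hasDerivAt_abs_rpow_add_one hp (f x + t * g x)).comp t
      (((hasDerivAt_id t).mul_const (g x)).const_add (f x))
    refine h.congr_deriv ?_
    ring

theorem hasDerivAt_integral_abs_rpow_mul_mul (hp : 1 < p)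
    (hf : MemLp f (ENNReal.ofReal (p + 1)) μ) (hg : MemLp g (ENNReal.ofReal (p + 1)) μ) (t₀ : ℝ) :
    HasDerivAt (fun t => ∫ x, |f x + t * g x| ^ (p - 1) * (f x + t * g x) * g x ∂μ)
      (p * ∫ x, |f x + t₀ * g x| ^ (p - 1) * g x ^ 2 ∂μ) t₀ := by
  have hm (t : ℝ) : MemLp (fun x => f x + t * g x) (ENNReal.ofReal (p + 1)) μ :=
    hf.add (hg.const_mul t)
  have hb : MemLp (fun x => |f x| + (|t₀| + 1) * |g x|) (ENNReal.ofReal (p + 1)) μ :=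
    hf.abs.add (hg.abs.const_mul _)
  rw [← integral_const_mul]
  refine (hasDerivAt_integral_of_dominated_loc_of_deriv_le
    (F' := fun t x => p * (|f x + t * g x| ^ (p - 1) * g x ^ 2))
    (bound := fun x => p * ((|f x| + (|t₀| + 1) * |g x|) ^ (p - 1) * g x ^ 2))
    (Metric.ball_mem_nhds t₀ zero_lt_one)
    (Filter.Eventually.of_forall fun t => (integrable_abs_rpow_mul_mul hp (hm t) hg).1)
    (integrable_abs_rpow_mul_mul hp (hm t₀) hg)
    ((integrable_abs_rpow_mul_sq hp (hm t₀) hg).const_mul _).1 ?_ ?_ ?_).2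
  · refine Filter.Eventually.of_forall fun x t ht => ?_
    rw [Real.norm_of_nonneg (by positivity)]
    gcongr
    exact abs_add_mul_le_of_mem_ball ht
  · have h := integrable_abs_rpow_mul_sq hp hb hg
    refine (h.const_mul p).congr (Filter.Eventually.of_forall fun x => ?_)
    simp only
    rw [abs_of_nonneg (show 0 ≤ |f x| + (|t₀| + 1) * |g x| by positivity)]
  · refine Filter.Eventually.of_forall fun x t _ => ?_
    have h := ((hasDerivAt_abs_rpow_mul_self hp (f x + t * g x)).comp t
      (((hasDerivAt_id t).mul_const (g x)).const_add (f x))).mul_const (g x)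
    refine h.congr_deriv ?_
    ring

end Integrals

/-! ### Bilinear forms on the energy space and the implicit operator. -/

namespace Region

variable {d : ℕ} {R : Region d} {V : Space d → ℝ} {ω p α τ : ℝ}

/-! ### Functions underlying elements of `X` -/

theorem X.memLp_two_fn (u : R.X) : MemLp u.fn 2 R.meas := Lp.memLp _

theorem X.fn_add (u v : R.X) : (u + v).fn =ᵐ[R.meas] fun x => u.fn x + v.fn x :=
  Lp.coeFn_add _ _

theorem X.fn_sub (u v : R.X) : (u - v).fn =ᵐ[R.meas] fun x => u.fn x - v.fn x :=
  Lp.coeFn_sub _ _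

theorem X.fn_smul (c : ℝ) (u : R.X) : (c • u).fn =ᵐ[R.meas] fun x => c * u.fn x :=
  Lp.coeFn_smul _ _

/-- The inclusion `X → L²`. -/
def toL2 (R : Region d) : R.X →L[ℝ] Lp ℝ 2 R.meas :=
  (WithLp.fstL 2 ℝ _ _).comp R.sobolev.subtypeL

/-- The weak gradient `X → L²`. -/
def gradL2 (R : Region d) : R.X →L[ℝ] Lp (Space d) 2 R.meas :=
  (WithLp.sndL 2 ℝ _ _).comp R.sobolev.subtypeL

theorem inner_real_eq_mul (a b : ℝ) : ⟪a, b⟫ = a * b := by simp [mul_comm]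

/-- The `L²` inner product on `X`. -/
def massForm (R : Region d) : R.X →ₗ[ℝ] R.X →ₗ[ℝ] ℝ :=
  (innerₗ (Lp ℝ 2 R.meas)).compl₁₂ R.toL2.toLinearMap R.toL2.toLinearMap

/-- The Dirichlet form on `X`. -/
def dirichletForm (R : Region d) : R.X →ₗ[ℝ] R.X →ₗ[ℝ] ℝ :=
  (innerₗ (Lp (Space d) 2 R.meas)).compl₁₂ R.gradL2.toLinearMap R.gradL2.toLinearMap

theorem massForm_eq_inner (u v : R.X) : massForm R u v = ⟪u.1.fst, v.1.fst⟫ := rfl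

theorem dirichletForm_eq_inner (u v : R.X) : dirichletForm R u v = ⟪u.1.snd, v.1.snd⟫ := rfl

theorem massForm_apply (u v : R.X) : massForm R u v = ∫ x, u.fn x * v.fn x ∂(R.meas) := by
  rw [massForm_eq_inner, L2.inner_def]
  exact integral_congr_ae (Filter.Eventually.of_forall fun x => inner_real_eq_mul _ _)

theorem dirichletForm_apply (u v : R.X) :
    dirichletForm R u v = ∫ x, ⟪u.grad x, v.grad x⟫ ∂(R.meas) := by
  rw [dirichletForm_eq_inner, L2.inner_def]
  rfl

theorem massForm_comm (u v : R.X) : massForm R u v = massForm R v u := by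
  rw [massForm_eq_inner, massForm_eq_inner, real_inner_comm]

theorem dirichletForm_comm (u v : R.X) : dirichletForm R u v = dirichletForm R v u := by
  rw [dirichletForm_eq_inner, dirichletForm_eq_inner, real_inner_comm]

theorem massForm_self_nonneg (u : R.X) : 0 ≤ massForm R u u := by
  rw [massForm_eq_inner]
  exact real_inner_self_nonneg

theorem dirichletForm_self_nonneg (u : R.X) : 0 ≤ dirichletForm R u u := by
  rw [dirichletForm_eq_inner]
  exact real_inner_self_nonneg

theorem norm_sq_eq (u : R.X) : ‖u‖ ^ 2 = massForm R u u + dirichletForm R u u := by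
  rw [massForm_eq_inner, dirichletForm_eq_inner, real_inner_self_eq_norm_sq,
    real_inner_self_eq_norm_sq, Submodule.coe_norm]
  exact WithLp.prod_norm_sq_eq_of_L2 u.1

theorem abs_massForm_le (u v : R.X) : |massForm R u v| ≤ ‖u‖ * ‖v‖ := by
  rw [massForm_eq_inner]
  refine (abs_real_inner_le_norm _ _).trans ?_
  exact mul_le_mul (WithLp.norm_fst_le _ u.1) (WithLp.norm_fst_le _ v.1) (norm_nonneg _)
    (norm_nonneg _)

theorem abs_dirichletForm_le (u v : R.X) : |dirichletForm R u v| ≤ ‖u‖ * ‖v‖ := by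
  rw [dirichletForm_eq_inner]
  refine (abs_real_inner_le_norm _ _).trans ?_
  exact mul_le_mul (WithLp.norm_snd_le _ u.1) (WithLp.norm_snd_le _ v.1) (norm_nonneg _)
    (norm_nonneg _)

theorem memLp_mul_fn (hV : MemLp V ∞ R.meas) (u : R.X) :
    MemLp (fun x => V x * u.fn x) 2 R.meas :=
  MemLp.mul' (p := ∞) (q := 2) u.memLp_two_fn hV

theorem integrable_mul_mul (hV : MemLp V ∞ R.meas) (u v : R.X) :
    Integrable (fun x => V x * u.fn x * v.fn x) R.meas :=
  (memLp_mul_fn hV u).integrable_mul v.memLp_two_fn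

/-- The form of the potential on `X`. -/
def potentialForm (hV : MemLp V ∞ R.meas) : R.X →ₗ[ℝ] R.X →ₗ[ℝ] ℝ :=
  LinearMap.mk₂ ℝ (fun u v => ∫ x, V x * u.fn x * v.fn x ∂(R.meas))
    (fun u u' v => by
      rw [← integral_add (integrable_mul_mul hV u v) (integrable_mul_mul hV u' v)]
      refine integral_congr_ae ?_
      filter_upwards [X.fn_add u u'] with x hx
      rw [hx]; ring)
    (fun c u v => by
      rw [smul_eq_mul, ← integral_const_mul]
      refine integral_congr_ae ?_
      filter_upwards [X.fn_smul c u] with x hx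
      rw [hx]; ring)
    (fun u v v' => by
      rw [← integral_add (integrable_mul_mul hV u v) (integrable_mul_mul hV u v')]
      refine integral_congr_ae ?_
      filter_upwards [X.fn_add v v'] with x hx
      rw [hx]; ring)
    (fun c u v => by
      rw [smul_eq_mul, ← integral_const_mul]
      refine integral_congr_ae ?_
      filter_upwards [X.fn_smul c v] with x hx
      rw [hx]; ring)

theorem potentialForm_apply (hV : MemLp V ∞ R.meas) (u v : R.X) :
    potentialForm hV u v = ∫ x, V x * u.fn x * v.fn x ∂(R.meas) := rfl

theorem potentialForm_comm (hV : MemLp V ∞ R.meas) (u v : R.X) :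
    potentialForm hV u v = potentialForm hV v u := by
  rw [potentialForm_apply, potentialForm_apply]
  congr with x
  ring

theorem exists_abs_potentialForm_le (hV : MemLp V ∞ R.meas) (u : R.X) :
    ∃ K, ∀ v : R.X, |potentialForm hV u v| ≤ K * ‖v‖ := by
  refine ⟨‖(memLp_mul_fn hV u).toLp‖, fun v => ?_⟩
  have h : potentialForm hV u v = ⟪(memLp_mul_fn hV u).toLp, v.1.fst⟫ := by
    rw [L2.inner_def, potentialForm_apply]
    refine integral_congr_ae ?_
    filter_upwards [(memLp_mul_fn hV u).coeFn_toLp] with x hx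
    rw [hx]
    exact (inner_real_eq_mul _ _).symm
  rw [h]
  refine (abs_real_inner_le_norm _ _).trans ?_
  gcongr
  exact WithLp.norm_fst_le _ v.1

theorem potentialForm_self_nonneg (hV : MemLp V ∞ R.meas) (hV0 : ∀ᵐ x ∂(R.meas), 0 ≤ V x)
    (u : R.X) : 0 ≤ potentialForm hV u u := by
  refine integral_nonneg_of_ae ?_
  filter_upwards [hV0] with x hx
  rw [mul_assoc]
  exact mul_nonneg hx (mul_self_nonneg _)

/-- The bilinear form of `-½Δ + V + ω`. -/
def energyForm (hV : MemLp V ∞ R.meas) (ω : ℝ) : R.X →ₗ[ℝ] R.X →ₗ[ℝ] ℝ :=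
  (1 / 2 : ℝ) • dirichletForm R + potentialForm hV + ω • massForm R

theorem energyForm_apply (hV : MemLp V ∞ R.meas) (u v : R.X) :
    energyForm hV ω u v =
      1 / 2 * dirichletForm R u v + potentialForm hV u v + ω * massForm R u v := by
  simp [energyForm]

theorem energyForm_comm (hV : MemLp V ∞ R.meas) (u v : R.X) :
    energyForm hV ω u v = energyForm hV ω v u := by
  rw [energyForm_apply, energyForm_apply, dirichletForm_comm, potentialForm_comm, massForm_comm]

theorem Q_eq_energyForm (hV : MemLp V ∞ R.meas) (u : R.X) : Q V ω u = energyForm hV ω u u := by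
  rw [energyForm_apply, Q, dirichletForm_apply, massForm_apply, potentialForm_apply]
  simp_rw [real_inner_self_eq_norm_sq, mul_assoc, sq]

/-- The bilinear form of the implicit part of the scheme. -/
def stepForm (R : Region d) (α τ : ℝ) : R.X →ₗ[ℝ] R.X →ₗ[ℝ] ℝ :=
  (1 / τ + α) • massForm R + (1 / 2 : ℝ) • dirichletForm R

theorem stepForm_apply (u v : R.X) :
    stepForm R α τ u v = (1 / τ + α) * massForm R u v + 1 / 2 * dirichletForm R u v := by
  simp [stepForm]

theorem stepForm_comm (u v : R.X) : stepForm R α τ u v = stepForm R α τ v u := by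
  rw [stepForm_apply, stepForm_apply, dirichletForm_comm, massForm_comm]

theorem stepForm_self_nonneg (hα : 0 ≤ α) (hτ : 0 < τ) (u : R.X) : 0 ≤ stepForm R α τ u u := by
  rw [stepForm_apply]
  have := massForm_self_nonneg u
  have := dirichletForm_self_nonneg u
  positivity

theorem stepForm_sq_le (hα : 0 ≤ α) (hτ : 0 < τ) (u v : R.X) :
    stepForm R α τ u v ^ 2 ≤ stepForm R α τ u u * stepForm R α τ v v :=
  LinearMap.BilinForm.apply_sq_le_of_symm _ (stepForm_self_nonneg hα hτ)
    ⟨stepForm_comm⟩ u v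

/-- Lax–Milgram: since `α ≥ 1/2`, both coefficients of the form are at least `1/2`, so it is
coercive for every `τ`. -/
theorem exists_stepForm_eq (hα : 1 / 2 ≤ α) (hτ : 0 < τ) (ℓ : R.X →L[ℝ] ℝ) :
    ∃ w : R.X, ∀ v, stepForm R α τ w v = ℓ v := by
  have hτ' : 0 < 1 / τ := by positivity
  let B : R.X →L[ℝ] R.X →L[ℝ] ℝ :=
    (stepForm R α τ).mkContinuous₂ (1 / τ + α + 1 / 2) fun u v => by
      rw [stepForm_apply, Real.norm_eq_abs]
      refine (abs_add_le _ _).trans ?_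
      rw [abs_mul, abs_mul, abs_of_nonneg (show 0 ≤ 1 / τ + α by linarith),
        abs_of_nonneg (show (0 : ℝ) ≤ 1 / 2 by norm_num)]
      have h1 := mul_le_mul_of_nonneg_left (abs_massForm_le u v) (show 0 ≤ 1 / τ + α by linarith)
      have h2 := abs_dirichletForm_le u v
      linarith
  have hB : IsCoercive B := by
    refine ⟨1 / 2, by norm_num, fun u => ?_⟩
    change _ ≤ stepForm R α τ u u
    rw [stepForm_apply, mul_assoc, ← sq, norm_sq_eq]
    have := mul_le_mul_of_nonneg_right (show 1 / 2 ≤ 1 / τ + α by linarith) (massForm_self_nonneg u)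
    linarith
  have : CompleteSpace R.X :=
    (Submodule.isClosed_topologicalClosure (Submodule.span ℝ R.smoothPairs)).completeSpace_coe
  refine ⟨hB.continuousLinearEquivOfBilin.symm ((InnerProductSpace.toDual ℝ R.X).symm ℓ),
    fun v => ?_⟩
  change B _ v = _
  rw [← hB.continuousLinearEquivOfBilin_apply, ContinuousLinearEquiv.apply_symm_apply,
    InnerProductSpace.toDual_symm_apply]

/-! ### Bounds on the quadratic functional -/

theorem lambda0_mul_massForm_le (hV : MemLp V ∞ R.meas) (hV0 : ∀ᵐ x ∂(R.meas), 0 ≤ V x)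
    (u : R.X) :
    lambda0 R V * massForm R u u ≤ 1 / 2 * dirichletForm R u u + potentialForm hV u u := by
  have hnn (u : R.X) : 0 ≤ 1 / 2 * dirichletForm R u u + potentialForm hV u u := by
    have := dirichletForm_self_nonneg u
    have := potentialForm_self_nonneg hV hV0 u
    positivity
  have hrw (u : R.X) : (1 / 2) * ∫ x, ‖u.grad x‖ ^ 2 ∂(R.meas) + ∫ x, V x * u.fn x ^ 2 ∂(R.meas) =
      1 / 2 * dirichletForm R u u + potentialForm hV u u := by
    rw [dirichletForm_apply, potentialForm_apply]
    simp_rw [real_inner_self_eq_norm_sq, mul_assoc, sq]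
  have hrw' (u : R.X) : ∫ x, u.fn x ^ 2 ∂(R.meas) = massForm R u u := by
    rw [massForm_apply]
    simp_rw [sq]
  rcases (massForm_self_nonneg u).eq_or_lt with h | h
  · rw [← h, mul_zero]
    exact hnn u
  · set m := massForm R u u
    have hs : √m * √m = m := Real.mul_self_sqrt h.le
    have hs0 : 0 < √m := Real.sqrt_pos.2 h
    -- Normalizing `u` in `L²` makes it a competitor in the infimum defining `lambda0`.
    have hle : lambda0 R V ≤ 1 / 2 * dirichletForm R ((√m)⁻¹ • u) ((√m)⁻¹ • u) +
        potentialForm hV ((√m)⁻¹ • u) ((√m)⁻¹ • u) := by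
      refine csInf_le ⟨0, ?_⟩ ⟨(√m)⁻¹ • u, ?_, (hrw _).symm⟩
      · rintro q ⟨v, -, rfl⟩
        rw [hrw]
        exact hnn v
      · rw [hrw']
        simp only [map_smul, LinearMap.smul_apply, smul_eq_mul]
        change (√m)⁻¹ * ((√m)⁻¹ * m) = 1
        rw [← mul_assoc, ← mul_inv, hs, inv_mul_cancel₀ h.ne']
    simp only [map_smul, LinearMap.smul_apply, smul_eq_mul] at hle
    have hs' (y : ℝ) : (√m)⁻¹ * ((√m)⁻¹ * y) = m⁻¹ * y := by rw [← mul_assoc, ← mul_inv, hs]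
    rw [hs', hs'] at hle
    calc lambda0 R V * m ≤ _ := mul_le_mul_of_nonneg_right hle h.le
      _ = _ := by field_simp

theorem exists_energyForm_coercive (hV : MemLp V ∞ R.meas) (hV0 : ∀ᵐ x ∂(R.meas), 0 ≤ V x)
    (hω : -lambda0 R V < ω) : ∃ c, 0 < c ∧ ∀ u : R.X, c * ‖u‖ ^ 2 ≤ energyForm hV ω u u := by
  set κ := lambda0 R V + ω with hκ
  have hκ0 : 0 < κ := by linarith
  have hs : 0 < κ + |ω| := by positivity
  -- The spectral bound controls only the mass, the crude bound `½g - |ω|m` only the gradient. They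
  -- are averaged with weights `1 - θ` and `θ`, where `θ` leaves exactly `κ/2` in front of the mass.
  set θ := κ / (2 * (κ + |ω|)) with hθ
  have hθ0 : 0 < θ := by positivity
  have hθs : θ * (κ + |ω|) = κ / 2 := by rw [hθ]; field_simp
  have hθ1 : θ ≤ 1 := by
    rw [hθ, div_le_one (by positivity)]
    linarith [abs_nonneg ω]
  refine ⟨min (θ / 2) (κ / 2), by positivity, fun u => ?_⟩
  have h1 := lambda0_mul_massForm_le hV hV0 u
  have hm := massForm_self_nonneg u
  have hg := dirichletForm_self_nonneg u
  have hb := potentialForm_self_nonneg hV hV0 u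
  rw [norm_sq_eq, energyForm_apply]
  set m := massForm R u u
  set g := dirichletForm R u u
  set b := potentialForm hV u u
  have h2 : κ * m ≤ 1 / 2 * g + b + ω * m := by rw [hκ]; linarith
  have h3 : 1 / 2 * g - |ω| * m ≤ 1 / 2 * g + b + ω * m := by
    have := mul_le_mul_of_nonneg_right (neg_abs_le ω) hm
    linarith
  have h4 := mul_le_mul_of_nonneg_left h2 (sub_nonneg.2 hθ1)
  have h5 := mul_le_mul_of_nonneg_left h3 hθ0.le
  have h6 := mul_le_mul_of_nonneg_right (min_le_left (θ / 2) (κ / 2)) hg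
  have h7 := mul_le_mul_of_nonneg_right (min_le_right (θ / 2) (κ / 2)) hm
  have h8 : θ * (κ + |ω|) * m = κ / 2 * m := by rw [hθs]
  linarith

/-- The stabilization condition says precisely that `V + ω ≤ 2α - 1` almost everywhere. -/
theorem energyForm_self_le (hV : MemLp V ∞ R.meas)
    (hα : (1 / 2) * max 0 (essSup (fun x => V x + ω) R.meas) + 1 / 2 ≤ α) (u : R.X) :
    energyForm hV ω u u ≤ 1 / 2 * dirichletForm R u u + (2 * α - 1) * massForm R u u := by
  -- A real-valued `essSup` dominates the function only once an essential upper bound is known.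
  have hbdd : Filter.IsBoundedUnder (· ≤ ·) (ae R.meas) fun x => V x + ω := by
    refine ⟨lpNorm V ∞ R.meas + ω, ?_⟩
    rw [Filter.eventually_map]
    filter_upwards [ae_le_lpNorm_exponent_top hV] with x hx
    linarith [(le_abs_self (V x)).trans hx]
  have hle : ∀ᵐ x ∂(R.meas), V x + ω ≤ 2 * α - 1 := by
    filter_upwards [ae_le_essSup hbdd] with x hx
    linarith [le_max_right 0 (essSup (fun x => V x + ω) R.meas)]
  have h2 : Integrable (fun x => u.fn x * u.fn x) R.meas :=
    u.memLp_two_fn.integrable_mul u.memLp_two_fn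
  have h : potentialForm hV u u + ω * massForm R u u ≤ (2 * α - 1) * massForm R u u := by
    rw [potentialForm_apply, massForm_apply, ← integral_const_mul, ← integral_const_mul,
      ← integral_add (integrable_mul_mul hV u u) (h2.const_mul _)]
    refine integral_mono_ae ((integrable_mul_mul hV u u).add (h2.const_mul _)) (h2.const_mul _) ?_
    filter_upwards [hle] with x hx
    have := mul_le_mul_of_nonneg_right hx (mul_self_nonneg (u.fn x))
    change V x * u.fn x * u.fn x + ω * (u.fn x * u.fn x) ≤ (2 * α - 1) * (u.fn x * u.fn x)
    linarith
  rw [energyForm_apply]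
  linarith

/-! ### The `L^{p+1}` norm on `X` and its derivatives -/

/-- The functional `v ↦ ∫ |u|^{p-1} u v`. -/
def powForm (p : ℝ) (u v : R.X) : ℝ := ∫ x, |u.fn x| ^ (p - 1) * u.fn x * v.fn x ∂(R.meas)

/-- The quadratic functional `v ↦ ∫ |u|^{p-1} v²`. -/
def weightForm (p : ℝ) (u v : R.X) : ℝ := ∫ x, |u.fn x| ^ (p - 1) * v.fn x ^ 2 ∂(R.meas)

theorem normLp_nonneg (u : R.X) : 0 ≤ normLp p u := lpNorm_nonneg

theorem normLp_eq (hp : 1 < p) (u : R.X) :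
    normLp p u = (∫ x, |u.fn x| ^ (p + 1) ∂(R.meas)) ^ (1 / (p + 1)) := by
  rw [normLp, lpNorm_eq_integral_norm_rpow_toReal (by rw [Ne, ENNReal.ofReal_eq_zero]; linarith)
    ENNReal.ofReal_ne_top u.memLp_two_fn.1, ENNReal.toReal_ofReal (by linarith), one_div]
  rfl

theorem integral_abs_rpow_nonneg (u : R.X) : 0 ≤ ∫ x, |u.fn x| ^ (p + 1) ∂(R.meas) :=
  integral_nonneg fun x => by positivity

theorem normLp_rpow (hp : 1 < p) (u : R.X) (s : ℝ) :
    normLp p u ^ s = (∫ x, |u.fn x| ^ (p + 1) ∂(R.meas)) ^ (s / (p + 1)) := by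
  rw [normLp_eq hp, ← Real.rpow_mul (integral_abs_rpow_nonneg u), one_div_mul_eq_div]

theorem normLp_rpow_add_one (hp : 1 < p) (u : R.X) :
    normLp p u ^ (p + 1) = ∫ x, |u.fn x| ^ (p + 1) ∂(R.meas) := by
  rw [normLp_rpow hp, div_self (by linarith), Real.rpow_one]

theorem normLp_smul (c : ℝ) (u : R.X) : normLp p (c • u) = |c| * normLp p u := by
  have h := lpNorm_const_smul c u.fn R.meas (p := ENNReal.ofReal (p + 1))
  rw [normLp, normLp, ← Real.norm_eq_abs, ← coe_nnnorm, ← h]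
  unfold lpNorm
  rw [if_pos (X.memLp_two_fn _).1, if_pos (u.memLp_two_fn.1.const_smul c),
    eLpNorm_congr_ae (X.fn_smul c u)]
  rfl

theorem powForm_self (hp : 1 < p) (u : R.X) : powForm p u u = normLp p u ^ (p + 1) := by
  rw [normLp_rpow_add_one hp, powForm]
  refine integral_congr_ae (Filter.Eventually.of_forall fun x => ?_)
  simp only
  rw [abs_rpow_add_one_eq p hp]
  ring

theorem powForm_smul (c : ℝ) (u v : R.X) : powForm p u (c • v) = c * powForm p u v := by
  rw [powForm, powForm, ← integral_const_mul]
  refine integral_congr_ae ?_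
  filter_upwards [X.fn_smul c v] with x hx
  rw [hx]
  ring

section

variable (hL : ∀ u : R.X, MemLp u.fn (ENNReal.ofReal (p + 1)) R.meas)
include hL

theorem normLp_add_le (hp : 1 < p) (u v : R.X) :
    normLp p (u + v) ≤ normLp p u + normLp p v := by
  have h := lpNorm_add_le (hL u) (g := v.fn)
    (by rw [← ENNReal.ofReal_one]; exact ENNReal.ofReal_le_ofReal (by linarith))
  refine le_trans (le_of_eq ?_) h
  rw [normLp]
  unfold lpNorm
  rw [if_pos (X.memLp_two_fn _).1, if_pos (u.memLp_two_fn.1.add v.memLp_two_fn.1),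
    eLpNorm_congr_ae (X.fn_add u v)]
  rfl

theorem powForm_add (hp : 1 < p) (u v w : R.X) :
    powForm p u (v + w) = powForm p u v + powForm p u w := by
  rw [powForm, powForm, powForm, ← integral_add (integrable_abs_rpow_mul_mul hp (hL u) (hL v))
    (integrable_abs_rpow_mul_mul hp (hL u) (hL w))]
  refine integral_congr_ae ?_
  filter_upwards [X.fn_add v w] with x hx
  rw [hx]
  ring

theorem powForm_sub (hp : 1 < p) (u v w : R.X) :
    powForm p u (v - w) = powForm p u v - powForm p u w := by
  rw [sub_eq_add_neg, ← neg_one_smul ℝ w, powForm_add hL hp, powForm_smul]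
  ring

theorem abs_powForm_le (hp : 1 < p) (u v : R.X) :
    |powForm p u v| ≤ normLp p u ^ p * normLp p v := by
  rw [normLp_rpow hp, normLp_eq hp v]
  exact abs_integral_abs_rpow_mul_mul_le hp (hL u) (hL v)

theorem weightForm_le (hp : 1 < p) (u v : R.X) :
    weightForm p u v ≤ normLp p u ^ (p - 1) * normLp p v ^ 2 := by
  rw [← Real.rpow_natCast (normLp p v), normLp_rpow hp, normLp_rpow hp]
  exact integral_abs_rpow_mul_sq_le hp (hL u) (hL v)

theorem exists_normLp_taylor (hp : 1 < p) {ε : ℝ} (hε : 0 < ε) :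
    ∃ C, 0 ≤ C ∧ ∀ u ξ : R.X,
      |normLp p (u + ξ) ^ (p + 1) - normLp p u ^ (p + 1) - (p + 1) * powForm p u ξ
        - (p + 1) * p / 2 * weightForm p u ξ| ≤
      ε * weightForm p u ξ + C * normLp p ξ ^ (p + 1) := by
  obtain ⟨C, hC0, hC⟩ := exists_integral_taylor (μ := R.meas) hp hε
  refine ⟨C, hC0, fun u ξ => ?_⟩
  have h : normLp p (u + ξ) ^ (p + 1) = ∫ x, |u.fn x + ξ.fn x| ^ (p + 1) ∂(R.meas) := by
    rw [normLp_rpow_add_one hp]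
    refine integral_congr_ae ?_
    filter_upwards [X.fn_add u ξ] with x hx
    rw [hx]
  rw [h, normLp_rpow_add_one hp, normLp_rpow_add_one hp]
  exact hC _ _ (hL u) (hL ξ)

theorem exists_powForm_antisymm_le (hp : 1 < p) {ε : ℝ} (hε : 0 < ε) :
    ∃ C, 0 ≤ C ∧ ∀ u ξ : R.X, normLp p (u + ξ) = normLp p u →
      |powForm p (u + ξ) u - powForm p u (u + ξ)| ≤
      ε * weightForm p u ξ + C * normLp p ξ ^ (p + 1) := by
  obtain ⟨C, hC0, hC⟩ := exists_integral_antisymm_le (μ := R.meas) hp hε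
  refine ⟨C, hC0, fun u ξ heq => ?_⟩
  have h : normLp p (u + ξ) ^ (p + 1) = ∫ x, |u.fn x + ξ.fn x| ^ (p + 1) ∂(R.meas) := by
    rw [normLp_rpow_add_one hp]
    refine integral_congr_ae ?_
    filter_upwards [X.fn_add u ξ] with x hx
    rw [hx]
  have h1 : powForm p (u + ξ) u =
      ∫ x, |u.fn x + ξ.fn x| ^ (p - 1) * (u.fn x + ξ.fn x) * u.fn x ∂(R.meas) := by
    refine integral_congr_ae ?_
    filter_upwards [X.fn_add u ξ] with x hx
    rw [hx]
  have h2 : powForm p u (u + ξ) =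
      ∫ x, |u.fn x| ^ (p - 1) * u.fn x * (u.fn x + ξ.fn x) ∂(R.meas) := by
    refine integral_congr_ae ?_
    filter_upwards [X.fn_add u ξ] with x hx
    rw [hx]
  rw [h1, h2, normLp_rpow_add_one hp]
  refine hC _ _ (hL u) (hL ξ) ?_
  rw [← h, heq, normLp_rpow_add_one hp]

/-- Along a line `Q` is a quadratic polynomial, and the power of the `L^{p+1}` norm can be
differentiated twice under the integral. This makes the non-degeneracy hypothesis an inequality
between explicit forms. -/
theorem secondVariation_eq (hp : 1 < p) (hV : MemLp V ∞ R.meas) (u ξ : R.X) (l : ℝ) :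
    secondVariation V ω p u l ξ = 2 * (energyForm hV ω ξ ξ - l * (p * weightForm p u ξ)) := by
  have hfun : (fun t : ℝ => lagrangian V ω p (u + t • ξ) l) = fun t =>
      energyForm hV ω u u + 2 * energyForm hV ω u ξ * t + energyForm hV ω ξ ξ * t ^ 2
        - l * (2 / (p + 1) * (∫ x, |u.fn x + t * ξ.fn x| ^ (p + 1) ∂(R.meas) - 1)) := by
    funext t
    rw [lagrangian, G, Q_eq_energyForm hV, normLp_rpow_add_one hp]
    have h : ∫ x, |(u + t • ξ).fn x| ^ (p + 1) ∂(R.meas) =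
        ∫ x, |u.fn x + t * ξ.fn x| ^ (p + 1) ∂(R.meas) := by
      refine integral_congr_ae ?_
      filter_upwards [X.fn_add u (t • ξ), X.fn_smul t ξ] with x hx hx'
      rw [hx, hx']
    rw [h]
    simp only [map_add, map_smul, LinearMap.add_apply, LinearMap.smul_apply, smul_eq_mul]
    rw [energyForm_comm hV ξ u]
    ring
  have hd : deriv (fun t : ℝ => lagrangian V ω p (u + t • ξ) l) = fun t =>
      2 * energyForm hV ω u ξ + 2 * energyForm hV ω ξ ξ * t
        - 2 * l * ∫ x, |u.fn x + t * ξ.fn x| ^ (p - 1) * (u.fn x + t * ξ.fn x) * ξ.fn x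
          ∂(R.meas) := by
    funext t
    rw [hfun]
    have h1 := hasDerivAt_integral_abs_rpow hp (hL u) (hL ξ) t
    have h := ((((hasDerivAt_id t).const_mul (2 * energyForm hV ω u ξ)).const_add
      (energyForm hV ω u u)).add (((hasDerivAt_id t).pow 2).const_mul (energyForm hV ω ξ ξ))).sub
      (((h1.sub_const 1).const_mul (2 / (p + 1))).const_mul l)
    refine (h.congr_deriv ?_).deriv
    have hp1 : p + 1 ≠ 0 := by linarith
    simp only [id]
    field_simp
    push_cast
    ring
  rw [secondVariation, iteratedDeriv_succ, iteratedDeriv_one, hd]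
  have h1 := hasDerivAt_integral_abs_rpow_mul_mul hp (hL u) (hL ξ) 0
  have h := (((hasDerivAt_id (0 : ℝ)).const_mul (2 * energyForm hV ω ξ ξ)).const_add
      (2 * energyForm hV ω u ξ)).sub (h1.const_mul (2 * l))
  refine (h.congr_deriv ?_).deriv
  simp only [zero_mul, add_zero, weightForm]
  ring

end

theorem multiplier_of_mem_sphere {u : R.X} (hu : u ∈ sphere R p) :
    multiplier V ω p u = Q V ω u := by
  have hu1 : normLp p u = 1 := hu
  rw [multiplier, hu1, Real.one_rpow, div_one]

theorem inv_normLp_smul_mem_sphere {w : R.X} (hw : normLp p w ≠ 0) :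
    (normLp p w)⁻¹ • w ∈ sphere R p := by
  change normLp p _ = 1
  rw [normLp_smul, abs_of_nonneg (inv_nonneg.2 (normLp_nonneg w)), inv_mul_cancel₀ hw]

theorem Q_smul (hV : MemLp V ∞ R.meas) (c : ℝ) (w : R.X) :
    Q V ω (c • w) = c ^ 2 * Q V ω w := by
  rw [Q_eq_energyForm hV, Q_eq_energyForm hV]
  simp only [map_smul, LinearMap.smul_apply, smul_eq_mul]
  ring

theorem ne_zero_of_mem_sphere {u : R.X} (hu : u ∈ sphere R p) : u ≠ 0 := by
  rintro rfl
  have h1 : normLp p (0 : R.X) = 1 := hu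
  have h0 := normLp_smul (p := p) 0 (0 : R.X)
  rw [zero_smul, abs_zero, zero_mul, h1] at h0
  exact one_ne_zero h0

/-! ### The Euler substep and energy dissipation. -/

section

variable (hL : ∀ u : R.X, MemLp u.fn (ENNReal.ofReal (p + 1)) R.meas)
include hL

/-- Written for the increment `w - u`, the explicit and implicit `α` terms merge into the form on
the left, and the right side is minus the constrained gradient of `Q` at `u`. -/
theorem isEulerStep_iff (hp : 1 < p) (hV : MemLp V ∞ R.meas) (u w : R.X) :
    IsEulerStep V ω p α τ u w ↔ ∀ v, stepForm R α τ (w - u) v =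
      -(energyForm hV ω u v - multiplier V ω p u * powForm p u v) := by
  refine forall_congr' fun v => ?_
  have h1 : ∫ x, (w.fn x - u.fn x) * v.fn x ∂(R.meas) = massForm R (w - u) v := by
    rw [massForm_apply]
    refine integral_congr_ae ?_
    filter_upwards [X.fn_sub w u] with x hx
    rw [hx]
  have h2 : ∫ x, (V x + ω - multiplier V ω p u * |u.fn x| ^ (p - 1) - α) * u.fn x * v.fn x
      ∂(R.meas) = potentialForm hV u v + ω * massForm R u v
        - multiplier V ω p u * powForm p u v - α * massForm R u v := by
    have i1 := integrable_mul_mul hV u v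
    have i2 : Integrable (fun x => u.fn x * v.fn x) R.meas :=
      u.memLp_two_fn.integrable_mul v.memLp_two_fn
    have i3 := integrable_abs_rpow_mul_mul hp (hL u) (hL v)
    have i4 := i2.const_mul ω
    have i5 := i2.const_mul α
    have i6 := i3.const_mul (multiplier V ω p u)
    have i14 : Integrable (fun x => V x * u.fn x * v.fn x + ω * (u.fn x * v.fn x)) R.meas :=
      i1.add i4
    have i146 : Integrable (fun x => V x * u.fn x * v.fn x + ω * (u.fn x * v.fn x)
        - multiplier V ω p u * (|u.fn x| ^ (p - 1) * u.fn x * v.fn x)) R.meas := i14.sub i6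
    rw [potentialForm_apply, massForm_apply, powForm, ← integral_const_mul, ← integral_const_mul,
      ← integral_const_mul, ← integral_add i1 i4, ← integral_sub i14 i6, ← integral_sub i146 i5]
    refine integral_congr_ae (Filter.Eventually.of_forall fun x => ?_)
    simp only
    ring
  rw [h1, h2, ← dirichletForm_apply, ← massForm_apply, stepForm_apply, energyForm_apply]
  simp only [map_sub, LinearMap.sub_apply]
  constructor <;> intro h <;> linarith

theorem exists_isEulerStep (hp : 1 < p) (hV : MemLp V ∞ R.meas) (hα : 1 / 2 ≤ α) (hτ : 0 < τ)
    {S : ℝ} (hS : ∀ u : R.X, normLp p u ≤ S * ‖u‖) (u : R.X) :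
    ∃ w, IsEulerStep V ω p α τ u w := by
  let f : R.X →ₗ[ℝ] ℝ :=
    { toFun := fun v => -(energyForm hV ω u v - multiplier V ω p u * powForm p u v)
      map_add' := fun v w => by rw [map_add, powForm_add hL hp]; ring
      map_smul' := fun c v => by
        rw [map_smul, powForm_smul, smul_eq_mul, smul_eq_mul, RingHom.id_apply]; ring }
  obtain ⟨K, hK⟩ := exists_abs_potentialForm_le hV u
  let ℓ : R.X →L[ℝ] ℝ := f.mkContinuous (1 / 2 * ‖u‖ + K + |ω| * ‖u‖
      + |multiplier V ω p u| * (normLp p u ^ p * S)) fun v => by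
    change ‖-(energyForm hV ω u v - multiplier V ω p u * powForm p u v)‖ ≤ _
    rw [norm_neg, Real.norm_eq_abs, energyForm_apply]
    have h1 := abs_dirichletForm_le u v
    have h2 := hK v
    have h3 := mul_le_mul_of_nonneg_left (abs_massForm_le u v) (abs_nonneg ω)
    have h4 : |powForm p u v| ≤ normLp p u ^ p * (S * ‖v‖) :=
      (abs_powForm_le hL hp u v).trans
        (mul_le_mul_of_nonneg_left (hS v) (Real.rpow_nonneg (normLp_nonneg u) p))
    have h5 := mul_le_mul_of_nonneg_left h4 (abs_nonneg (multiplier V ω p u))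
    refine (abs_sub _ _).trans ((add_le_add_left ((abs_add_le _ _).trans
      (add_le_add_left (abs_add_le _ _) _)) _).trans ?_)
    rw [abs_mul, abs_mul, abs_mul, abs_of_nonneg (show (0 : ℝ) ≤ 1 / 2 by norm_num)]
    linarith
  obtain ⟨e, he⟩ := exists_stepForm_eq hα hτ ℓ
  refine ⟨u + e, (isEulerStep_iff hL hp hV u _).2 fun v => ?_⟩
  rw [add_sub_cancel_left, he]
  rfl

/-- The amount of energy dissipated by the Euler substep with increment `e`. -/
def dissipation (τ : ℝ) (e : R.X) : ℝ :=
  (2 / τ + 1) * massForm R e e + 1 / 2 * dirichletForm R e e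

omit hL in
-- This gives control of the increment in `H¹` uniformly in `τ`.
theorem half_norm_sq_le_dissipation (hτ : 0 < τ) (e : R.X) :
    1 / 2 * ‖e‖ ^ 2 ≤ dissipation τ e := by
  rw [norm_sq_eq, dissipation]
  have hm := massForm_self_nonneg e
  have : 0 ≤ 2 / τ * massForm R e e := by positivity
  linarith

/-- Testing the step with the increment `e` replaces `2 E(u, e)` by `2 Q(u) N - 2 B(e, e)`; the
bound `energyForm_self_le` on `E(e, e)` uses up part of `2 B(e, e)`, and the rest is the
dissipation. -/
theorem energyForm_le_of_isEulerStep (hp : 1 < p) (hV : MemLp V ∞ R.meas)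
    (hα : (1 / 2) * max 0 (essSup (fun x => V x + ω) R.meas) + 1 / 2 ≤ α)
    {u w : R.X} (hu : u ∈ sphere R p) (hw : IsEulerStep V ω p α τ u w) :
    energyForm hV ω w w ≤
      Q V ω u * (1 + 2 * powForm p u (w - u)) - dissipation τ (w - u) := by
  obtain ⟨e, rfl⟩ : ∃ e, w = u + e := ⟨w - u, by abel⟩
  have h := (isEulerStep_iff hL hp hV u _).1 hw
  rw [add_sub_cancel_left] at h ⊢
  have h1 := h e
  have h2 := energyForm_self_le (ω := ω) hV hα e
  rw [multiplier_of_mem_sphere hu, stepForm_apply] at h1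
  simp only [map_add, LinearMap.add_apply]
  rw [energyForm_comm hV e u, Q_eq_energyForm hV] at *
  rw [dissipation]
  have : 2 / τ = 2 * (1 / τ) := by ring
  rw [this]
  linarith

/-- Energy dissipation of one step of the scheme, without restriction on the step size. -/
theorem energy_decay (hp : 1 < p) (hV : MemLp V ∞ R.meas)
    (hα : (1 / 2) * max 0 (essSup (fun x => V x + ω) R.meas) + 1 / 2 ≤ α) (hτ : 0 < τ)
    {c : ℝ} (hc0 : 0 < c) (hc : ∀ u : R.X, c * ‖u‖ ^ 2 ≤ energyForm hV ω u u)
    {u w : R.X} (hu : u ∈ sphere R p) (hw : IsEulerStep V ω p α τ u w) :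
    normLp p w ≠ 0 ∧ Q V ω ((normLp p w)⁻¹ • w) * normLp p w ^ 2 ≤
      Q V ω u * normLp p w ^ 2 - dissipation τ (w - u) := by
  have hE := energyForm_le_of_isEulerStep hL hp hV hα hu hw
  have hD : 0 ≤ dissipation τ (w - u) :=
    le_trans (by positivity) (half_norm_sq_le_dissipation hτ (w - u))
  have hu1 : normLp p u = 1 := hu
  have hQ : 0 < Q V ω u := by
    rw [Q_eq_energyForm hV]
    refine lt_of_lt_of_le ?_ (hc u)
    have := norm_pos_iff.2 (ne_zero_of_mem_sphere hu)
    positivity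
  have hN : powForm p u w = 1 + powForm p u (w - u) := by
    rw [powForm_sub hL hp, powForm_self hp, hu1, Real.one_rpow]
    ring
  have hH := abs_powForm_le hL hp u w
  rw [hu1, Real.one_rpow, one_mul, hN] at hH
  set N := powForm p u (w - u)
  -- Hölder with `‖u‖ = 1` in `L^{p+1}`. Expanding the square gives `1 + 2N ≤ ‖w‖² - N²`, the
  -- inequality that pays for the normalization.
  have hsq : (1 + N) ^ 2 ≤ normLp p w ^ 2 := sq_le_sq' (by linarith [neg_abs_le (1 + N)])
    ((le_abs_self _).trans hH)
  have hle : Q V ω u * (1 + 2 * N) ≤ Q V ω u * (normLp p w ^ 2 - N ^ 2) :=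
    mul_le_mul_of_nonneg_left (by linarith) hQ.le
  -- If `‖w‖ = 0` then `N = -1`, and the energy estimate would make `E(w, w)` at most `-Q(u) < 0`.
  have hne : normLp p w ≠ 0 := by
    intro h0
    rw [h0] at hsq hle
    have hN1 : 1 + N = 0 := by nlinarith
    have hN2 : N = -1 := by linarith
    rw [hN2] at hE
    have := (by positivity : 0 ≤ c * ‖w‖ ^ 2).trans (hc w)
    linarith
  refine ⟨hne, ?_⟩
  rw [Q_smul hV, inv_pow, mul_right_comm, inv_mul_cancel₀ (pow_ne_zero 2 hne), one_mul,
    Q_eq_energyForm hV w]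
  have := mul_nonneg hQ.le (sq_nonneg N)
  linarith

/-! ### Coercivity near the ground state. -/

theorem weightForm_sub_smul (hp : 1 < p) (u ξ : R.X) (c : ℝ) :
    weightForm p u (ξ - c • u) =
      weightForm p u ξ - 2 * c * powForm p u ξ + c ^ 2 * normLp p u ^ (p + 1) := by
  have i1 := integrable_abs_rpow_mul_sq hp (hL u) (hL ξ)
  have i2 := (integrable_abs_rpow_mul_mul hp (hL u) (hL ξ)).const_mul (2 * c)
  have i3 := (integrable_abs_rpow hp (hL u)).const_mul (c ^ 2)
  have i12 : Integrable (fun x => |u.fn x| ^ (p - 1) * ξ.fn x ^ 2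
    - 2 * c * (|u.fn x| ^ (p - 1) * u.fn x * ξ.fn x)) R.meas := i1.sub i2
  rw [normLp_rpow_add_one hp, weightForm, weightForm, powForm, ← integral_const_mul,
    ← integral_const_mul, ← integral_sub i1 i2, ← integral_add i12 i3]
  refine integral_congr_ae ?_
  filter_upwards [X.fn_sub ξ (c • u), X.fn_smul c u] with x hx hx'
  rw [hx, hx', abs_rpow_add_one_eq p hp]
  ring

/-- The Euler–Lagrange equation of a ground state. -/
theorem IsGroundState.energyForm_eq (hp : 1 < p) (hV : MemLp V ∞ R.meas)
    (hpos : ∀ u : R.X, 0 ≤ energyForm hV ω u u) {ug : R.X} (hug : IsGroundState V ω p ug)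
    (v : R.X) : energyForm hV ω ug v = Q V ω ug * powForm p ug v := by
  have hug1 : normLp p ug = 1 := hug.1
  set l := Q V ω ug with hl
  have hl0 : 0 ≤ l := by rw [hl, Q_eq_energyForm hV]; exact hpos ug
  -- Minimality and Hölder extend the minimum property to all of `X`: a quadratic inequality with
  -- equality at `ug`. Along `ug + t v` its constant term vanishes, which forces the linear
  -- coefficient to vanish too.
  have hle (w : R.X) : l * powForm p ug w ^ 2 ≤ energyForm hV ω w w := by
    have h1 := abs_powForm_le hL hp ug w
    rw [hug1, Real.one_rpow, one_mul] at h1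
    rcases eq_or_ne (normLp p w) 0 with h0 | h0
    · rw [h0] at h1
      rw [abs_eq_zero.1 (le_antisymm h1 (abs_nonneg _))]
      simpa using hpos w
    · have h2 := hug.2 _ (inv_normLp_smul_mem_sphere h0)
      rw [Q_smul hV, Q_eq_energyForm hV w, inv_pow, inv_mul_eq_div, le_div_iff₀ (by positivity)]
        at h2
      refine le_trans ?_ h2
      exact mul_le_mul_of_nonneg_left (sq_le_sq.2 (h1.trans (le_abs_self _))) hl0
  suffices h : energyForm hV ω ug v - l * powForm p ug v = 0 by linarith
  refine eq_zero_of_forall_nonneg_quadratic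
    (c := energyForm hV ω v v - l * powForm p ug v ^ 2) fun t => ?_
  have h := hle (ug + t • v)
  rw [powForm_add hL hp, powForm_smul, powForm_self hp, hug1, Real.one_rpow] at h
  simp only [map_add, map_smul, LinearMap.add_apply, LinearMap.smul_apply, smul_eq_mul] at h
  rw [energyForm_comm hV v ug, ← Q_eq_energyForm hV ug] at h
  linarith

/-- Smallness of the remainders of the Taylor expansion at a point of the sphere. -/
theorem exists_remainder_le (hp : 1 < p) {S : ℝ} (hS0 : 0 ≤ S)
    (hS : ∀ u : R.X, normLp p u ≤ S * ‖u‖) {ug : R.X} (hug : ug ∈ sphere R p) {η : ℝ}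
    (hη : 0 < η) :
    ∃ δ, 0 < δ ∧ ∀ ξ : R.X, ‖ξ‖ ≤ δ → ug + ξ ∈ sphere R p →
      |powForm p ug ξ + p / 2 * weightForm p ug ξ| ≤ η * ‖ξ‖ ^ 2 ∧
      |powForm p (ug + ξ) ug - powForm p ug (ug + ξ)| ≤ η * ‖ξ‖ ^ 2 := by
  have hug1 : normLp p ug = 1 := hug
  -- The weighted term costs `S²` and the power term `1`, whence the denominator. For the latter
  -- `‖ξ‖^(p+1) ≤ δ^(p-1) ‖ξ‖²`, which is small since `p > 1`.
  set ε := η / (S ^ 2 + 1) with hε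
  have hε0 : 0 < ε := by positivity
  obtain ⟨C₁, hC₁0, hC₁⟩ := exists_normLp_taylor hL hp hε0
  obtain ⟨C₂, hC₂0, hC₂⟩ := exists_powForm_antisymm_le hL hp hε0
  obtain ⟨δ, hδ0, hδ⟩ : ∃ δ : ℝ, 0 < δ ∧ (C₁ + C₂) * S ^ (p + 1) * δ ^ (p - 1) < ε := by
    have hcont : ContinuousAt (fun δ : ℝ => (C₁ + C₂) * S ^ (p + 1) * δ ^ (p - 1)) 0 :=
      continuousAt_const.mul (continuousAt_id.rpow_const (Or.inr (by linarith)))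
    have h := hcont.tendsto.mono_left (nhdsWithin_le_nhds (s := Ioi 0))
    simp only [Real.zero_rpow (show p - 1 ≠ 0 by linarith), mul_zero] at h
    obtain ⟨δ, h1, h2⟩ := ((h.eventually_lt_const hε0).and self_mem_nhdsWithin).exists
    exact ⟨δ, h2, h1⟩
  refine ⟨δ, hδ0, fun ξ hξ hsph => ?_⟩
  have hsph1 : normLp p (ug + ξ) = 1 := hsph
  have hZ : weightForm p ug ξ ≤ S ^ 2 * ‖ξ‖ ^ 2 := by
    have h := weightForm_le hL hp ug ξ
    rw [hug1, Real.one_rpow, one_mul] at h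
    refine h.trans ?_
    rw [← mul_pow]
    exact pow_le_pow_left₀ (normLp_nonneg ξ) (hS ξ) 2
  have hP : (C₁ + C₂) * normLp p ξ ^ (p + 1) ≤ ε * ‖ξ‖ ^ 2 := by
    have h1 : normLp p ξ ^ (p + 1) ≤ S ^ (p + 1) * (δ ^ (p - 1) * ‖ξ‖ ^ 2) := by
      refine (Real.rpow_le_rpow (normLp_nonneg ξ) (hS ξ) (by linarith)).trans ?_
      rw [Real.mul_rpow hS0 (norm_nonneg _)]
      gcongr
      have h2 := abs_rpow_add_one_eq p hp ‖ξ‖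
      rw [abs_norm] at h2
      rw [h2]
      gcongr
    calc (C₁ + C₂) * normLp p ξ ^ (p + 1)
        ≤ (C₁ + C₂) * (S ^ (p + 1) * (δ ^ (p - 1) * ‖ξ‖ ^ 2)) := by gcongr
      _ = (C₁ + C₂) * S ^ (p + 1) * δ ^ (p - 1) * ‖ξ‖ ^ 2 := by ring
      _ ≤ ε * ‖ξ‖ ^ 2 := by gcongr
  have hn : 0 ≤ normLp p ξ ^ (p + 1) := Real.rpow_nonneg (normLp_nonneg ξ) _
  have hεη : ε * (S ^ 2 + 1) = η := by rw [hε]; field_simp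
  have hsum : ε * weightForm p ug ξ + (C₁ + C₂) * normLp p ξ ^ (p + 1) ≤ η * ‖ξ‖ ^ 2 := by
    rw [← hεη]
    have := mul_le_mul_of_nonneg_left hZ hε0.le
    linarith
  have h1 := hC₁ ug ξ
  have h2 := hC₂ ug ξ (by rw [hsph1, hug1])
  rw [hsph1, hug1, sub_self, zero_sub] at h1
  have hn1 := mul_nonneg hC₁0 hn
  have hn2 := mul_nonneg hC₂0 hn
  constructor
  · have h3 : -((p + 1) * powForm p ug ξ) - (p + 1) * p / 2 * weightForm p ug ξ =
        -((p + 1) * (powForm p ug ξ + p / 2 * weightForm p ug ξ)) := by ring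
    rw [h3, abs_neg, abs_mul, abs_of_nonneg (show 0 ≤ p + 1 by linarith)] at h1
    have h4 := le_mul_of_one_le_left (abs_nonneg (powForm p ug ξ + p / 2 * weightForm p ug ξ))
      (show 1 ≤ p + 1 by linarith)
    linarith
  · linarith

/-- The Euler–Lagrange equation evaluates the linear term; the sign is Hölder's inequality between
two points of the unit sphere. -/
theorem IsGroundState.energy_excess_le (hp : 1 < p) (hV : MemLp V ∞ R.meas)
    (hpos : ∀ u : R.X, 0 ≤ energyForm hV ω u u) {ug ξ : R.X} (hug : IsGroundState V ω p ug)
    (hξ : ug + ξ ∈ sphere R p) :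
    Q V ω (ug + ξ) - Q V ω ug = energyForm hV ω ξ ξ + 2 * Q V ω ug * powForm p ug ξ ∧
      powForm p ug ξ ≤ 0 := by
  have hug1 : normLp p ug = 1 := hug.1
  have hξ1 : normLp p (ug + ξ) = 1 := hξ
  constructor
  · have h := hug.energyForm_eq hL hp hV hpos ξ
    rw [Q_eq_energyForm hV (ug + ξ)]
    simp only [map_add, LinearMap.add_apply]
    rw [energyForm_comm hV ξ ug, h, ← Q_eq_energyForm hV ug]
    ring
  · have h := (le_abs_self _).trans (abs_powForm_le hL hp ug (ug + ξ))
    rw [powForm_add hL hp, powForm_self hp, hug1, hξ1, Real.one_rpow, Real.one_rpow] at h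
    linarith

/-- This splits the gradient pairing into the excess times a factor close to one, plus an
antisymmetric defect that is `o(‖ξ‖²)`. -/
theorem IsGroundState.pairing_eq (hp : 1 < p) (hV : MemLp V ∞ R.meas)
    (hpos : ∀ u : R.X, 0 ≤ energyForm hV ω u u) {ug ξ : R.X} (hug : IsGroundState V ω p ug)
    (hξ : ug + ξ ∈ sphere R p) :
    energyForm hV ω (ug + ξ) ξ - Q V ω (ug + ξ) * powForm p (ug + ξ) ξ =
      (Q V ω (ug + ξ) - Q V ω ug) * powForm p (ug + ξ) ug
        + Q V ω ug * (powForm p (ug + ξ) ug - powForm p ug (ug + ξ)) := by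
  have hξ1 : normLp p (ug + ξ) = 1 := hξ
  have h1 : powForm p (ug + ξ) ξ = 1 - powForm p (ug + ξ) ug := by
    have := powForm_add hL hp (ug + ξ) ug ξ
    rw [powForm_self hp, hξ1, Real.one_rpow] at this
    linarith
  have h2 : energyForm hV ω (ug + ξ) ξ = Q V ω (ug + ξ) - Q V ω ug * powForm p ug (ug + ξ) := by
    have := (energyForm hV ω (ug + ξ)).map_add ug ξ
    rw [Q_eq_energyForm hV (ug + ξ), this, energyForm_comm hV (ug + ξ) ug,
      hug.energyForm_eq hL hp hV hpos]
    ring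
  rw [h1, h2]
  ring

set_option maxHeartbeats 800000 in
/-- Near a non-degenerate ground state both the energy excess and the Łojasiewicz pairing are
bounded below by the squared distance. -/
theorem IsGroundState.exists_local_coercive (hp : 1 < p) (hV : MemLp V ∞ R.meas)
    {c A S : ℝ} (hc0 : 0 < c) (hc : ∀ u : R.X, c * ‖u‖ ^ 2 ≤ energyForm hV ω u u)
    (hA0 : 0 ≤ A) (hA : ∀ u : R.X, energyForm hV ω u u ≤ A * ‖u‖ ^ 2)
    (hS0 : 0 ≤ S) (hS : ∀ u : R.X, normLp p u ≤ S * ‖u‖) {ug : R.X}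
    (hug : IsGroundState V ω p ug) (hnd : IsNondegenerate V ω p ug) :
    ∃ δ c₁, 0 < δ ∧ 0 < c₁ ∧ ∀ ξ : R.X, ‖ξ‖ ≤ δ → ug + ξ ∈ sphere R p →
      c₁ * ‖ξ‖ ^ 2 ≤ Q V ω (ug + ξ) - Q V ω ug ∧
      c₁ * ‖ξ‖ ^ 2 ≤
        energyForm hV ω (ug + ξ) ξ - Q V ω (ug + ξ) * powForm p (ug + ξ) ξ := by
  have hug1 : normLp p ug = 1 := hug.1
  have hpos (u : R.X) : 0 ≤ energyForm hV ω u u := (by positivity : 0 ≤ c * ‖u‖ ^ 2).trans (hc u)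
  have hEL := hug.energyForm_eq hL hp hV hpos
  obtain ⟨k, hk0, hk⟩ := hnd
  rw [multiplier_of_mem_sphere hug.1] at hk
  have hl0 : 0 < Q V ω ug := by
    rw [Q_eq_energyForm hV]
    refine lt_of_lt_of_le ?_ (hc ug)
    have := norm_pos_iff.2 (ne_zero_of_mem_sphere hug.1)
    positivity
  have hexc := fun ξ (h : ug + ξ ∈ sphere R p) => hug.energy_excess_le hL hp hV hpos h
  have hmin := fun ξ (h : ug + ξ ∈ sphere R p) => hug.2 _ h
  have hQg : energyForm hV ω ug ug = Q V ω ug := (Q_eq_energyForm hV ug).symm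
  set l := Q V ω ug with hl
  set η := k / (64 * l) with hη
  have hη0 : 0 < η := by positivity
  have hηl : 64 * (l * η) = k := by rw [hη]; field_simp
  obtain ⟨δ₁, hδ₁0, hδ₁⟩ := exists_remainder_le hL hp hS0 hS hug.1 hη0
  -- Nonnegativity of the excess gives `-2 l N ≤ E(ξ, ξ) ≤ A ‖ξ‖²`, so the normal component `N` of
  -- `ξ` is at most `B ‖ξ‖²` in absolute value.
  set B := A / (2 * l) with hB
  have hB0 : 0 ≤ B := by positivity
  have hBl : 2 * l * B = A := by rw [hB]; field_simp
  -- The three smallness conditions ensure that the tangent part keeps half the norm of `ξ`, that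
  -- the `N²` error stays below `k/32 ‖ξ‖²`, and that the factor `powForm p (ug + ξ) ug` is at least
  -- `1/2`.
  obtain ⟨δ, hδ0, hδle, hs1, hs2, hs3⟩ : ∃ δ : ℝ, 0 < δ ∧ δ ≤ δ₁ ∧ B * ‖ug‖ * δ ≤ 1 / 2 ∧
      (p - 1) * l * B ^ 2 * δ ^ 2 ≤ k / 32 ∧ (B + η) * δ ^ 2 ≤ 1 / 2 := by
    have t (f : ℝ → ℝ) (hf : Continuous f) (h0 : f 0 = 0) {b : ℝ} (hb : 0 < b) :
        ∀ᶠ δ in nhdsWithin (0 : ℝ) (Ioi 0), f δ < b :=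
      ((h0 ▸ hf.tendsto 0).mono_left nhdsWithin_le_nhds).eventually_lt_const hb
    have e0 := t (fun δ => δ) continuous_id rfl hδ₁0
    have e1 := t (fun δ => B * ‖ug‖ * δ) (by fun_prop) (by simp) (b := 1 / 2) (by norm_num)
    have e2 := t (fun δ => (p - 1) * l * B ^ 2 * δ ^ 2) (by fun_prop) (by simp)
      (b := k / 32) (by positivity)
    have e3 := t (fun δ => (B + η) * δ ^ 2) (by fun_prop) (by simp) (b := 1 / 2) (by norm_num)
    obtain ⟨δ, h0, h1, h2, h3, h4⟩ :=
      (e0.and (e1.and (e2.and (e3.and self_mem_nhdsWithin)))).exists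
    exact ⟨δ, h4, h0.le, h1.le, h2.le, h3.le⟩
  refine ⟨δ, k / 64, hδ0, by positivity, fun ξ hξ hsph => ?_⟩
  have hsph1 : normLp p (ug + ξ) = 1 := hsph
  obtain ⟨hr1, hr2⟩ := hδ₁ ξ (hξ.trans hδle) hsph
  obtain ⟨hE, hN0⟩ := hexc ξ hsph
  have hE0 := hmin ξ hsph
  have haA := hA ξ
  have hpow : powForm p ug (ug + ξ) = 1 + powForm p ug ξ := by
    rw [powForm_add hL hp, powForm_self hp, hug1, Real.one_rpow]
  set N := powForm p ug ξ with hN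
  set Z := weightForm p ug ξ with hZ
  set a := energyForm hV ω ξ ξ with ha
  set n := ‖ξ‖ with hn
  have hn0 : 0 ≤ n := norm_nonneg ξ
  have hnδ : n ^ 2 ≤ δ ^ 2 := pow_le_pow_left₀ hn0 hξ 2
  have hNB : |N| ≤ B * n ^ 2 := by
    rw [abs_of_nonpos hN0]
    have h1 : 2 * l * (-N) ≤ 2 * l * (B * n ^ 2) := by
      rw [← mul_assoc (2 * l) B, hBl]
      linarith
    exact le_of_mul_le_mul_left h1 (by positivity)
  -- comparison with the tangent component
  have hT : powForm p ug (ξ - N • ug) = 0 := by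
    rw [powForm_sub hL hp, powForm_smul, powForm_self hp, hug1, Real.one_rpow]
    ring
  have hH := hk (ξ - N • ug) hT
  rw [secondVariation_eq hL hp hV, weightForm_sub_smul hL hp, hug1, Real.one_rpow] at hH
  have haT : energyForm hV ω (ξ - N • ug) (ξ - N • ug) = a - l * N ^ 2 := by
    simp only [map_sub, map_smul, LinearMap.sub_apply, LinearMap.smul_apply, smul_eq_mul]
    rw [energyForm_comm hV ξ ug, hEL, hQg, ← hN, ← ha]
    ring
  rw [haT, ← hN, ← hZ] at hH
  have hnT : 1 / 2 * n ≤ ‖ξ - N • ug‖ := by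
    have h1 : n - |N| * ‖ug‖ ≤ ‖ξ - N • ug‖ := by
      have := norm_sub_norm_le ξ (N • ug)
      rwa [norm_smul, Real.norm_eq_abs] at this
    have h2 : |N| * ‖ug‖ ≤ 1 / 2 * n := by
      calc |N| * ‖ug‖ ≤ B * n ^ 2 * ‖ug‖ := by gcongr
        _ = B * ‖ug‖ * n * n := by ring
        _ ≤ B * ‖ug‖ * δ * n := by gcongr
        _ ≤ 1 / 2 * n := by gcongr
    linarith
  have hnT2 : 1 / 4 * n ^ 2 ≤ ‖ξ - N • ug‖ ^ 2 := by
    have := pow_le_pow_left₀ (by positivity) hnT 2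
    linarith [this, show (1 / 2 * n) ^ 2 = 1 / 4 * n ^ 2 by ring]
  have hN2 : (p - 1) * l * N ^ 2 ≤ k / 32 * n ^ 2 := by
    have hp1 : 0 ≤ p - 1 := by linarith
    calc (p - 1) * l * N ^ 2 = (p - 1) * l * |N| ^ 2 := by rw [sq_abs]
      _ ≤ (p - 1) * l * (B * n ^ 2) ^ 2 := by gcongr
      _ = (p - 1) * l * B ^ 2 * n ^ 2 * n ^ 2 := by ring
      _ ≤ (p - 1) * l * B ^ 2 * δ ^ 2 * n ^ 2 := by gcongr
      _ ≤ k / 32 * n ^ 2 := by gcongr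
  have hk4 := mul_le_mul_of_nonneg_left hnT2 hk0.le
  have hr1' := mul_le_mul_of_nonneg_left (abs_le.1 hr1).1 (show 0 ≤ 2 * l by positivity)
  -- Non-degeneracy contributes `k/8`; the `N²` error and the Taylor remainder take `k/32` each,
  -- leaving `k/16`.
  have hlow : k / 16 * n ^ 2 ≤ Q V ω (ug + ξ) - l := by
    rw [hE]
    have : 2 * l * (η * n ^ 2) = k / 32 * n ^ 2 := by rw [← hηl]; ring
    linarith
  have hkn : 0 ≤ k * n ^ 2 := by positivity
  refine ⟨by linarith, ?_⟩
  -- the pairing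
  rw [hug.pairing_eq hL hp hV hpos hsph, ← hl]
  have hr2l := (abs_le.1 hr2).1
  have hhalf : 1 / 2 ≤ powForm p (ug + ξ) ug := by
    have h1 : (B + η) * n ^ 2 ≤ 1 / 2 := le_trans (by gcongr) hs3
    rw [hpow] at hr2l
    linarith [(abs_le.1 hNB).1]
  have h3 : k / 32 * n ^ 2 ≤ (Q V ω (ug + ξ) - l) * powForm p (ug + ξ) ug := by
    have h4 := mul_le_mul hlow hhalf (by norm_num) (sub_nonneg.2 hE0)
    linarith
  have h5 := mul_le_mul_of_nonneg_left hr2l hl0.le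
  have : l * (-(η * n ^ 2)) = -(k / 64 * n ^ 2) := by rw [← hηl]; ring
  linarith

/-! ### Contraction of the energy excess in one step. -/

/-- With `r` the `L^{p+1}` norm of `w`, the difference is `r⁻¹ ((w - u) + (u - ug) + (1 - r) ug)`,
and `|1 - r| ≤ S ‖w - u‖` by the embedding. -/
theorem norm_inv_normLp_smul_sub_le (hp : 1 < p) {S : ℝ} (hS : ∀ u : R.X, normLp p u ≤ S * ‖u‖)
    {u w ug : R.X} (hu : u ∈ sphere R p) (hSe : S * ‖w - u‖ ≤ 1 / 2) :
    normLp p w ≤ 2 ∧ ‖(normLp p w)⁻¹ • w - ug‖ ≤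
      2 * (‖w - u‖ + ‖u - ug‖ + S * ‖w - u‖ * ‖ug‖) := by
  have hu1 : normLp p u = 1 := hu
  have hle : normLp p w ≤ 1 + S * ‖w - u‖ := by
    have h := normLp_add_le hL hp u (w - u)
    rw [add_sub_cancel, hu1] at h
    exact h.trans (add_le_add_right (hS _) 1)
  have hge : 1 - S * ‖w - u‖ ≤ normLp p w := by
    have h := normLp_add_le hL hp w (u - w)
    rw [add_sub_cancel, hu1] at h
    have := hS (u - w)
    rw [norm_sub_rev] at this
    linarith
  set r := normLp p w
  have hr : 1 / 2 ≤ r := by linarith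
  have hr0 : 0 < r := by linarith
  refine ⟨by linarith, ?_⟩
  have h1 : r⁻¹ • w - ug = r⁻¹ • ((w - u) + (u - ug) + (1 - r) • ug) := by
    rw [sub_smul, one_smul, show w - u + (u - ug) + (ug - r • ug) = w - r • ug by abel, smul_sub,
      inv_smul_smul₀ hr0.ne']
  have h2 : r⁻¹ ≤ 2 := by
    rw [inv_le_comm₀ hr0 (by norm_num)]
    linarith
  rw [h1, norm_smul, Real.norm_of_nonneg (inv_nonneg.2 hr0.le)]
  gcongr
  refine (norm_add_le _ _).trans (add_le_add (norm_add_le _ _) ?_)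
  rw [norm_smul]
  gcongr
  rw [Real.norm_eq_abs, abs_le]
  constructor <;> linarith

omit hL in
-- The factor `(1+τ)/τ` is the source of the rate `τ/(1+τ)`.
theorem stepForm_self_le (hα : 1 / 2 ≤ α) (hτ : 0 < τ) (v : R.X) :
    stepForm R α τ v v ≤ (α + 1) * ((1 + τ) / τ) * ‖v‖ ^ 2 := by
  rw [stepForm_apply, norm_sq_eq]
  have hm := massForm_self_nonneg v
  have hg := dirichletForm_self_nonneg v
  have ht : 0 < 1 / τ := by positivity
  have h1 : (1 + τ) / τ = 1 / τ + 1 := by field_simp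
  have h2 : 0 < α * (1 / τ) := by positivity
  have h3 : 1 / τ + α ≤ (α + 1) * (1 / τ + 1) := by linarith
  have h4 : 1 / 2 ≤ (α + 1) * (1 / τ + 1) := by linarith
  rw [h1, mul_add]
  gcongr

omit hL in
theorem stepForm_self_le_dissipation (hα : 1 / 2 ≤ α) (hτ : 0 < τ) (e : R.X) :
    stepForm R α τ e e ≤ 2 * α * dissipation τ e := by
  rw [stepForm_apply, dissipation]
  have hm := massForm_self_nonneg e
  have hg := dirichletForm_self_nonneg e
  have ht : 0 < 1 / τ := by positivity
  have h2 : 2 / τ = 2 * (1 / τ) := by ring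
  have h3 : 1 / τ + α ≤ 2 * α * (2 / τ + 1) := by
    rw [h2]
    have := mul_le_mul_of_nonneg_right hα ht.le
    linarith
  have h4 := mul_le_mul_of_nonneg_right h3 hm
  have h5 := mul_le_mul_of_nonneg_right hα hg
  linarith

/-- Lower bound on the dissipation of an Euler substep near a non-degenerate ground state. -/
theorem le_dissipation_of_isEulerStep (hp : 1 < p) (hV : MemLp V ∞ R.meas) (hα : 1 / 2 ≤ α)
    (hτ : 0 < τ) {c : ℝ} (hc : 0 < c) {u w ξ : R.X} (hu : u ∈ sphere R p)
    (hw : IsEulerStep V ω p α τ u w)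
    (hF : c * ‖ξ‖ ^ 2 ≤ energyForm hV ω u ξ - Q V ω u * powForm p u ξ) :
    c ^ 2 / (2 * α * (α + 1)) * (τ / (1 + τ)) * ‖ξ‖ ^ 2 ≤ dissipation τ (w - u) := by
  have hD : 0 ≤ dissipation τ (w - u) :=
    le_trans (by positivity) (half_norm_sq_le_dissipation hτ (w - u))
  rcases eq_or_ne ξ 0 with rfl | hξ
  · simpa using hD
  have hξ0 : 0 < ‖ξ‖ ^ 2 := by
    have := norm_pos_iff.2 hξ
    positivity
  have h1 := (isEulerStep_iff hL hp hV u w).1 hw ξ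
  rw [multiplier_of_mem_sphere hu] at h1
  -- Cauchy–Schwarz for the implicit form itself, rather than for the `H¹` norm, keeps the final
  -- constant free of `τ`.
  have h2 := stepForm_sq_le (α := α) (by linarith) hτ (w - u) ξ
  rw [h1, neg_sq] at h2
  have h3 : (c * ‖ξ‖ ^ 2) ^ 2 ≤
      2 * α * dissipation τ (w - u) * ((α + 1) * ((1 + τ) / τ) * ‖ξ‖ ^ 2) :=
    (pow_le_pow_left₀ (by positivity) hF 2).trans (h2.trans (mul_le_mul
      (stepForm_self_le_dissipation hα hτ _) (stepForm_self_le hα hτ ξ)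
      (stepForm_self_nonneg (by linarith) hτ ξ) (by positivity)))
  have hα0 : 0 < α := by linarith
  have h4 : c ^ 2 * ‖ξ‖ ^ 2 ≤ dissipation τ (w - u) * (2 * α * (α + 1) * ((1 + τ) / τ)) := by
    refine le_of_mul_le_mul_right ?_ hξ0
    linarith
  have h5 : c ^ 2 / (2 * α * (α + 1)) * (τ / (1 + τ)) * ‖ξ‖ ^ 2 =
      c ^ 2 * ‖ξ‖ ^ 2 / (2 * α * (α + 1) * ((1 + τ) / τ)) := by field_simp
  rw [h5, div_le_iff₀ (by positivity)]
  exact h4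

/-- One step of the scheme near a non-degenerate ground state contracts the energy excess. -/
theorem IsGroundState.exists_step_contraction (hp : 1 < p) (hV : MemLp V ∞ R.meas)
    (hα : (1 / 2) * max 0 (essSup (fun x => V x + ω) R.meas) + 1 / 2 ≤ α)
    {c S : ℝ} (hc0 : 0 < c) (hc : ∀ u : R.X, c * ‖u‖ ^ 2 ≤ energyForm hV ω u u)
    (hS0 : 0 ≤ S) (hS : ∀ u : R.X, normLp p u ≤ S * ‖u‖) {ug : R.X}
    (hug : IsGroundState V ω p ug) (hnd : IsNondegenerate V ω p ug) :
    ∃ δ c₁ κ K, 0 < δ ∧ 0 < c₁ ∧ 0 < κ ∧ 0 < K ∧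
      (∀ u ∈ sphere R p, Q V ω u - Q V ω ug ≤ K * ‖u - ug‖ ^ 2) ∧
      (∀ u ∈ sphere R p, ‖u - ug‖ ≤ δ → ∀ τ : ℝ, 0 < τ → ∀ w, IsEulerStep V ω p α τ u w →
        c₁ * ‖(normLp p w)⁻¹ • w - ug‖ ^ 2 ≤ Q V ω ((normLp p w)⁻¹ • w) - Q V ω ug ∧
        Q V ω ((normLp p w)⁻¹ • w) - Q V ω ug ≤
          (1 - κ * (τ / (1 + τ))) * (Q V ω u - Q V ω ug)) ∧
      ∀ u ∈ sphere R p, ‖u - ug‖ ≤ δ → c₁ * ‖u - ug‖ ^ 2 ≤ Q V ω u - Q V ω ug := by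
  have hα2 : 1 / 2 ≤ α := by linarith [le_max_left 0 (essSup (fun x => V x + ω) R.meas)]
  have hα0 : 0 < α := by linarith
  have hA (u : R.X) : energyForm hV ω u u ≤ 2 * α * ‖u‖ ^ 2 := by
    refine (energyForm_self_le hV hα u).trans ?_
    rw [norm_sq_eq]
    have hm := massForm_self_nonneg u
    have hg := dirichletForm_self_nonneg u
    have h1 := mul_le_mul_of_nonneg_right hα2 hg
    have h2 := mul_nonneg hα0.le hg
    linarith
  have hpos (u : R.X) : 0 ≤ energyForm hV ω u u := (by positivity : 0 ≤ c * ‖u‖ ^ 2).trans (hc u)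
  have hl0 : 0 ≤ Q V ω ug := by rw [Q_eq_energyForm hV]; exact hpos ug
  obtain ⟨δ, c₁, hδ0, hc₁, hloc⟩ :=
    hug.exists_local_coercive hL hp hV hc0 hc (by positivity) hA hS0 hS hnd
  have hloc' (u : R.X) (hu : u ∈ sphere R p) (h : ‖u - ug‖ ≤ δ) :=
    hloc (u - ug) h (by rwa [add_sub_cancel])
  simp only [add_sub_cancel] at hloc'
  have hup (u : R.X) (hu : u ∈ sphere R p) : Q V ω u - Q V ω ug ≤ 2 * α * ‖u - ug‖ ^ 2 := by
    have h := hug.energy_excess_le hL hp hV hpos (ξ := u - ug) (by rwa [add_sub_cancel])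
    rw [add_sub_cancel] at h
    rw [h.1]
    have := mul_nonneg (mul_nonneg zero_le_two hl0) (neg_nonneg.2 h.2)
    linarith [hA (u - ug)]
  -- From `½‖e‖² ≤ dissipation ≤ 2α ‖u - ug‖² ‖w‖²`, with `‖w‖` taken in `L^{p+1}`, one gets `‖e‖ ≤
  -- b ‖u - ug‖ ‖w‖`.
  set b := 2 * √α with hb
  have hb0 : 0 < b := by positivity
  have hb2 : b ^ 2 = 4 * α := by rw [hb, mul_pow, Real.sq_sqrt hα0.le]; norm_num
  set M := 2 * (2 * b + 1 + S * (2 * b) * ‖ug‖) with hM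
  have hM0 : 0 < M := by positivity
  -- The first condition makes normalization harmless; the second puts the new iterate back in the
  -- `δ`-ball where coercivity is known.
  obtain ⟨δ', hδ'0, hδ'δ, hs1, hs2⟩ : ∃ δ' : ℝ, 0 < δ' ∧ δ' ≤ δ ∧ S * (2 * b * δ') ≤ 1 / 2 ∧
      M * δ' ≤ δ := by
    refine ⟨min δ (min (1 / (4 * b * (S + 1))) (δ / M)), by positivity, min_le_left _ _, ?_, ?_⟩
    · have h1 : min δ (min (1 / (4 * b * (S + 1))) (δ / M)) ≤ 1 / (4 * b * (S + 1)) :=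
        (min_le_right _ _).trans (min_le_left _ _)
      rw [le_div_iff₀ (by positivity)] at h1
      have h2 : 0 ≤ min δ (min (1 / (4 * b * (S + 1))) (δ / M)) := by positivity
      nlinarith [mul_nonneg hb0.le h2]
    · have h1 : min δ (min (1 / (4 * b * (S + 1))) (δ / M)) ≤ δ / M :=
        (min_le_right _ _).trans (min_le_right _ _)
      rw [le_div_iff₀ hM0] at h1
      linarith
  -- The rate is the dissipation constant `c₁² / (2α(α+1))`, divided by `2α` to pass from squared
  -- distance to excess and by `4` because `‖w‖² ≤ 4` in `L^{p+1}`.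
  refine ⟨δ', c₁, c₁ ^ 2 / (16 * α ^ 2 * (α + 1)), 2 * α, hδ'0, hc₁, by positivity,
    by positivity, hup, fun u hu huδ τ hτ w hw => ?_,
    fun u hu huδ => (hloc' u hu (huδ.trans hδ'δ)).1⟩
  obtain ⟨hne, hdec⟩ := energy_decay hL hp hV hα hτ hc0 hc hu hw
  have hsph := inv_normLp_smul_mem_sphere hne
  have hmin := hug.2 _ hsph
  have hupu := hup u hu
  have hDe := half_norm_sq_le_dissipation hτ (w - u)
  set u' := (normLp p w)⁻¹ • w with hu'
  have hr0 : 0 < normLp p w := lt_of_le_of_ne (normLp_nonneg w) hne.symm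
  have hnw : normLp p w ≤ 1 + S * ‖w - u‖ := by
    have hu1 : normLp p u = 1 := hu
    have h := normLp_add_le hL hp u (w - u)
    rw [add_sub_cancel, hu1] at h
    exact h.trans (add_le_add_right (hS _) 1)
  have hD : dissipation τ (w - u) ≤ (Q V ω u - Q V ω u') * normLp p w ^ 2 := by linarith
  -- The norm of `w` itself involves `e`: inserting `‖w‖ ≤ 1 + S‖e‖` produces a term at most
  -- `‖e‖/4`, which is absorbed on the left.
  have he : ‖w - u‖ ≤ 2 * b * ‖u - ug‖ := by
    have h1 : ‖w - u‖ ^ 2 ≤ (b * ‖u - ug‖ * normLp p w) ^ 2 := by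
      have h2 : (Q V ω u - Q V ω u') * normLp p w ^ 2 ≤
          2 * α * ‖u - ug‖ ^ 2 * normLp p w ^ 2 := by gcongr; linarith
      have h3 : (b * ‖u - ug‖ * normLp p w) ^ 2 = 4 * α * ‖u - ug‖ ^ 2 * normLp p w ^ 2 := by
        rw [mul_pow, mul_pow, hb2]
      linarith
    have h4 : ‖w - u‖ ≤ b * ‖u - ug‖ * normLp p w :=
      le_of_sq_le_sq h1 (by positivity)
    have h5 : b * ‖u - ug‖ * normLp p w ≤ b * ‖u - ug‖ * (1 + S * ‖w - u‖) := by gcongr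
    have h6 : S * (2 * b * ‖u - ug‖) ≤ 1 / 2 := le_trans (by gcongr) hs1
    have h7 := mul_le_mul_of_nonneg_right h6 (norm_nonneg (w - u))
    have h8 := mul_nonneg hb0.le (norm_nonneg (u - ug))
    linarith
  have hSe : S * ‖w - u‖ ≤ 1 / 2 :=
    le_trans (mul_le_mul_of_nonneg_left (he.trans (by gcongr)) hS0) hs1
  obtain ⟨hr2, hdist⟩ := norm_inv_normLp_smul_sub_le hL hp hS (ug := ug) hu hSe
  have hu'δ : ‖u' - ug‖ ≤ δ := by
    refine hdist.trans (le_trans ?_ hs2)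
    calc 2 * (‖w - u‖ + ‖u - ug‖ + S * ‖w - u‖ * ‖ug‖)
        ≤ 2 * (2 * b * ‖u - ug‖ + ‖u - ug‖ + S * (2 * b * ‖u - ug‖) * ‖ug‖) := by gcongr
      _ = M * ‖u - ug‖ := by rw [hM]; ring
      _ ≤ M * δ' := by gcongr
  refine ⟨(hloc' u' hsph hu'δ).1, ?_⟩
  have hlow := le_dissipation_of_isEulerStep hL hp hV hα2 hτ hc₁ hu hw
    (hloc' u hu (huδ.trans hδ'δ)).2
  have hdiff : 0 ≤ Q V ω u - Q V ω u' := by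
    have h1 : 0 ≤ (Q V ω u - Q V ω u') * normLp p w ^ 2 := le_trans (by positivity) (hDe.trans hD)
    exact nonneg_of_mul_nonneg_left h1 (by positivity)
  have h4 : (Q V ω u - Q V ω u') * normLp p w ^ 2 ≤ (Q V ω u - Q V ω u') * 4 := by
    have : normLp p w ^ 2 ≤ 2 ^ 2 := pow_le_pow_left₀ hr0.le hr2 2
    exact mul_le_mul_of_nonneg_left (by linarith) hdiff
  have h5 : c₁ ^ 2 / (16 * α ^ 2 * (α + 1)) * (τ / (1 + τ)) * (Q V ω u - Q V ω ug) ≤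
      c₁ ^ 2 / (2 * α * (α + 1)) * (τ / (1 + τ)) * ‖u - ug‖ ^ 2 / 4 := by
    calc c₁ ^ 2 / (16 * α ^ 2 * (α + 1)) * (τ / (1 + τ)) * (Q V ω u - Q V ω ug)
        ≤ c₁ ^ 2 / (16 * α ^ 2 * (α + 1)) * (τ / (1 + τ)) * (2 * α * ‖u - ug‖ ^ 2) := by gcongr
      _ = _ := by field_simp; ring
  linarith

end

end Region

end GFALM

end

/-! ### Exponential convergence. -/

open GFALM GFALM.Region in
theorem theorem3p4 {d : ℕ} (hd : 1 ≤ d) (R : Region d) (hR : R.Admissible)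
    (p : ℝ) (hp : 1 < p) (hp' : 3 ≤ d → p < ((d : ℝ) + 2) / ((d : ℝ) - 2))
    (V : Space d → ℝ) (hV : MemLp V ∞ R.meas) (hV0 : ∀ᵐ x ∂(R.meas), 0 ≤ V x)
    (ω : ℝ) (hω : -lambda0 R V < ω)
    (α : ℝ) (hα : (1 / 2) * max 0 (essSup (fun x => V x + ω) R.meas) + 1 / 2 ≤ α)
    (ug : R.X) (hug : IsGroundState V ω p ug) (hnd : IsNondegenerate V ω p ug) :
    ∃ δ₀ C a : ℝ, 0 < δ₀ ∧ 0 < C ∧ 0 < a ∧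
      ∀ u₀ ∈ sphere R p, ‖u₀ - ug‖ ≤ δ₀ → ∀ τ : ℝ, 0 < τ →
        (∃ u : ℕ → R.X, u 0 = u₀ ∧ IsScheme V ω p α τ u) ∧
        ∀ u : ℕ → R.X, u 0 = u₀ → IsScheme V ω p α τ u →
          ∀ n : ℕ, ‖u n - ug‖ ≤ C * Real.exp (-(a * (n * τ / (1 + τ)))) := by
  have hq' : 3 ≤ d → (1 / 2 : ℝ) - 1 / d ≤ 1 / (p + 1).toNNReal := by
    intro h3
    have hd3 : (3 : ℝ) ≤ d := by exact_mod_cast h3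
    have h := hp' h3
    rw [lt_div_iff₀ (by linarith)] at h
    rw [Real.coe_toNNReal _ (by linarith), div_sub_div _ _ (by norm_num) (by positivity),
      div_le_div_iff₀ (by positivity) (by linarith)]
    linarith
  obtain ⟨S, hS⟩ := exists_eLpNorm_fn_le hd R hR (q := (p + 1).toNNReal)
    (by rw [← Real.toNNReal_one]; exact Real.toNNReal_le_toNNReal (by linarith)) hq'
  have hL (u : R.X) : MemLp u.fn (ENNReal.ofReal (p + 1)) R.meas :=
    ⟨u.memLp_two_fn.1, (hS u).trans_lt (ENNReal.mul_lt_top ENNReal.coe_lt_top enorm_lt_top)⟩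
  have hS' (u : R.X) : normLp p u ≤ S * ‖u‖ := by
    rw [normLp, ← toReal_eLpNorm u.memLp_two_fn.1]
    refine ENNReal.toReal_le_of_le_ofReal (by positivity) ((hS u).trans (le_of_eq ?_))
    rw [ENNReal.ofReal_mul (by positivity), ENNReal.ofReal_coe_nnreal, ofReal_norm]
  obtain ⟨c, hc0, hc⟩ := exists_energyForm_coercive hV hV0 hω
  have hα2 : 1 / 2 ≤ α := by linarith [le_max_left 0 (essSup (fun x => V x + ω) R.meas)]
  obtain ⟨δ, c₁, κ, K, hδ, hc₁, hκ, hK, hup, hstep, hlow⟩ :=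
    hug.exists_step_contraction hL hp hV hα hc0 hc S.2 hS' hnd
  -- The radius is chosen so that `K δ₀² ≤ c₁ δ²`: the initial excess then confines every later
  -- iterate to the `δ`-ball. The excess is quadratic in the distance, hence the square root in `C`
  -- and the halved rate.
  refine ⟨min δ (δ * √(c₁ / K)), √(K / c₁) * min δ (δ * √(c₁ / K)), κ / 2, by positivity,
    by positivity, by positivity, fun u₀ hu₀ hu₀δ τ hτ => ⟨?_, fun u hu0 hu n => ?_⟩⟩
  · choose! g hg using fun u : R.X => exists_isEulerStep (ω := ω) hL hp hV hα2 hτ hS' u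
    let u : ℕ → R.X := fun n => (fun v => (normLp p (g v))⁻¹ • g v)^[n] u₀
    have hsucc (n : ℕ) : u (n + 1) = (normLp p (g (u n)))⁻¹ • g (u n) :=
      Function.iterate_succ_apply' _ _ _
    have hsph (n : ℕ) : u n ∈ sphere R p := by
      induction n with
      | zero => exact hu₀
      | succ n ih =>
        rw [hsucc]
        exact inv_normLp_smul_mem_sphere (energy_decay hL hp hV hα hτ hc0 hc ih (hg _)).1
    exact ⟨u, rfl, fun n => ⟨g (u n), hg _,
      (energy_decay hL hp hV hα hτ hc0 hc (hsph n) (hg _)).1, hsucc n⟩⟩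
  · set δ₀ := min δ (δ * √(c₁ / K)) with hδ₀
    have hδ₀0 : 0 < δ₀ := by positivity
    have hE₀ : Q V ω u₀ - Q V ω ug ≤ K * δ₀ ^ 2 := (hup u₀ hu₀).trans (by gcongr)
    have hs : 0 ≤ τ / (1 + τ) := by positivity
    have hKδ : K * δ₀ ^ 2 ≤ c₁ * δ ^ 2 := by
      have h1 : δ₀ ^ 2 ≤ (δ * √(c₁ / K)) ^ 2 := pow_le_pow_left₀ hδ₀0.le (min_le_right _ _) 2
      rw [mul_pow, Real.sq_sqrt (by positivity)] at h1
      calc K * δ₀ ^ 2 ≤ K * (δ ^ 2 * (c₁ / K)) := by gcongr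
        _ = c₁ * δ ^ 2 := by field_simp
    have key (n : ℕ) : u n ∈ sphere R p ∧ ‖u n - ug‖ ≤ δ ∧
        Q V ω (u n) - Q V ω ug ≤ K * δ₀ ^ 2 * Real.exp (-(κ * (n * τ / (1 + τ)))) := by
      induction n with
      | zero =>
        rw [hu0]
        exact ⟨hu₀, hu₀δ.trans (min_le_left _ _), by simpa using hE₀⟩
      | succ n ih =>
        obtain ⟨h1, h2, h3⟩ := ih
        obtain ⟨w, hw, hne, hnext⟩ := hu n
        obtain ⟨h4, h5⟩ := hstep (u n) h1 h2 τ hτ w hw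
        rw [← hnext] at h4 h5
        have hsph : u (n + 1) ∈ sphere R p := by
          rw [hnext]
          exact inv_normLp_smul_mem_sphere hne
        have hE0 : 0 ≤ Q V ω (u n) - Q V ω ug := sub_nonneg.2 (hug.2 _ h1)
        have h6 : Q V ω (u (n + 1)) - Q V ω ug ≤
            K * δ₀ ^ 2 * Real.exp (-(κ * ((n + 1 : ℕ) * τ / (1 + τ)))) := by
          have h7 : 1 - κ * (τ / (1 + τ)) ≤ Real.exp (-(κ * (τ / (1 + τ)))) := by
            have := Real.add_one_le_exp (-(κ * (τ / (1 + τ))))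
            linarith
          calc Q V ω (u (n + 1)) - Q V ω ug
              ≤ (1 - κ * (τ / (1 + τ))) * (Q V ω (u n) - Q V ω ug) := h5
            _ ≤ Real.exp (-(κ * (τ / (1 + τ)))) * (Q V ω (u n) - Q V ω ug) := by gcongr
            _ ≤ Real.exp (-(κ * (τ / (1 + τ)))) *
                (K * δ₀ ^ 2 * Real.exp (-(κ * (n * τ / (1 + τ))))) := by gcongr
            _ = K * δ₀ ^ 2 * Real.exp (-(κ * ((n + 1 : ℕ) * τ / (1 + τ)))) := by
              rw [mul_left_comm, ← Real.exp_add]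
              congr 2
              push_cast
              ring
        refine ⟨hsph, ?_, h6⟩
        have h8 : K * δ₀ ^ 2 * Real.exp (-(κ * ((n + 1 : ℕ) * τ / (1 + τ)))) ≤ K * δ₀ ^ 2 :=
          mul_le_of_le_one_right (by positivity)
            (Real.exp_le_one_iff.2 (neg_nonpos.2 (by positivity)))
        -- Confinement comes from the energy: the coercivity bound at the new iterate and the
        -- decayed excess give back the radius `δ`, so the neighbourhood does not shrink with `n`.
        have h9 : c₁ * ‖u (n + 1) - ug‖ ^ 2 ≤ c₁ * δ ^ 2 := by linarith
        exact le_of_sq_le_sq (le_of_mul_le_mul_left h9 hc₁) hδ.le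
    obtain ⟨h1, h2, h3⟩ := key n
    have h4 := (hlow (u n) h1 h2).trans h3
    refine le_of_sq_le_sq ?_ (by positivity)
    rw [mul_pow, mul_pow, Real.sq_sqrt (by positivity), ← Real.exp_nat_mul]
    have h5 : ((2 : ℕ) : ℝ) * -(κ / 2 * (n * τ / (1 + τ))) = -(κ * (n * τ / (1 + τ))) := by
      push_cast; ring
    rw [h5]
    refine le_of_mul_le_mul_left (h4.trans (le_of_eq ?_)) hc₁
    field_simp
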